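/- Let $d\ge 1$, $0<\alpha\le 2$, $T>0$, and let $p,q\in[1,\infty]$ be conjugate exponents, $\frac1p+\frac1q=1$. Let $\mathbf v:(0,T)\times\mathbb R^d\to\mathbb R^d$ be a vector field such that $\mathbf v$ and its distributional spatial divergence $\operatorname{div}\mathbf v$ belong to $L^q_{loc}((0,T)\times\mathbb R^d)$. Let $\psi$ be a solution on $[0,T]\times\mathbb R^d$ of the conservative transport-diffusion equation $$\partial_s\psi(s)+(-\Delta)^{\alpha/2}\psi(s)=-\operatorname{div}\bigl(\mathbf v(s)\,\psi(s)\bigr),\qquad \psi(0,\cdot)=\psi_0,$$ where $(-\Delta)^{\alpha/2}$ is the Fourier multiplier by $|\xi|^\alpha$. Here a solution is a function $\psi\in C([0,T];L^1(\mathbb R^d))$ with $\psi(0,\cdot)=\psi_0$ almost everywhere, such that $\psi$ and its weak spatial gradient $\nabla\psi$ belong to $L^p_{loc}((0,T)\times\mathbb R^d)$, such that $$\int_a^b\!\int_{\mathbb R^d}\frac{|\mathbf v(s,x)|\,|\psi(s,x)|}{1+|x|}\,dx\,ds<\infty\qquad\text{for all } 0<a<b<T,$$ and such that the equation holds in the sense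 of distributions on $(0,T)\times\mathbb R^d$, i.e. for every $\varphi\in C_c^\infty((0,T)\times\mathbb R^d)$, $$\int_0^T\!\int_{\mathbb R^d}\psi\,\bigl(\partial_s\varphi+\mathbf v\cdot\nabla\varphi-(-\Delta)^{\alpha/2}\varphi\bigr)\,dx\,ds=0 .$$ Then, for every $s\in[0,T]$, $$\|\psi(s,\cdot)\|_{L^1}\le\|\psi_0\|_{L^1}\qquad\text{and}\qquad \int_{\mathbb R^d}\psi(s,x)\,dx=\int_{\mathbb R^d}\psi_0(x)\,dx .$$ -/

import Mathlib

open MeasureTheory Filter Topology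
open scoped ENNReal ContDiff FourierTransform

namespace TransportDiffusion

/-- The fractional Laplacian `(-Δ)^{α/2} f`, as the Fourier multiplier by `|ξ|^α`. It is only applied
to smooth compactly supported `f`. Mathlib's Fourier transform uses the character
`exp (-2πi⟪x, ξ⟫)`, so the frequency `|ξ|` of the usual convention is `2π‖ξ‖` here. The result is
real because the symbol is real and even; `re` only records it as a real number. -/
noncomputable def fracLaplacian {d : ℕ} (α : ℝ) (f : EuclideanSpace ℝ (Fin d) → ℝ)
    (x : EuclideanSpace ℝ (Fin d)) : ℝ :=
  (𝓕⁻ (fun ξ : EuclideanSpace ℝ (Fin d) =>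
    (((2 * Real.pi * ‖ξ‖) ^ α : ℝ) : ℂ) *
      𝓕 (fun y : EuclideanSpace ℝ (Fin d) => (f y : ℂ)) ξ) x).re

/-- The open space-time slab `(0, T) × ℝ^d`. -/
def slab (d : ℕ) (T : ℝ) : Set (ℝ × EuclideanSpace ℝ (Fin d)) :=
  Set.Ioo 0 T ×ˢ Set.univ

/-- Test functions on the slab: `φ ∈ C_c^∞((0, T) × ℝ^d)`. -/
def IsTest {d : ℕ} (T : ℝ) (φ : ℝ × EuclideanSpace ℝ (Fin d) → ℝ) : Prop :=
  ContDiff ℝ ∞ φ ∧ HasCompactSupport φ ∧ tsupport φ ⊆ slab d T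

/-- `f ∈ L^p_loc((0, T) × ℝ^d)`. -/
def MemLpLoc {d : ℕ} {F : Type*} [NormedAddCommGroup F] (T : ℝ) (p : ℝ≥0∞)
    (f : ℝ → EuclideanSpace ℝ (Fin d) → F) : Prop :=
  ∀ K : Set (ℝ × EuclideanSpace ℝ (Fin d)), IsCompact K → K ⊆ slab d T →
    MemLp (fun z : ℝ × EuclideanSpace ℝ (Fin d) => f z.1 z.2) p (volume.restrict K)

/-- The spatial directional derivative `(w · ∇_x) φ` at the space-time point `z`. -/
noncomputable def spaceDeriv {d : ℕ} (φ : ℝ × EuclideanSpace ℝ (Fin d) → ℝ)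
    (z : ℝ × EuclideanSpace ℝ (Fin d)) (w : EuclideanSpace ℝ (Fin d)) : ℝ :=
  fderiv ℝ (fun y => φ (z.1, y)) z.2 w

/-- The time derivative `∂_s φ` at the space-time point `z`. -/
noncomputable def timeDeriv {d : ℕ} (φ : ℝ × EuclideanSpace ℝ (Fin d) → ℝ)
    (z : ℝ × EuclideanSpace ℝ (Fin d)) : ℝ :=
  deriv (fun s => φ (s, z.2)) z.1

/-- `D` is the weak spatial divergence of the field `v` on `(0, T) × ℝ^d`. -/
def IsWeakDiv {d : ℕ} (T : ℝ)
    (v : ℝ → EuclideanSpace ℝ (Fin d) → EuclideanSpace ℝ (Fin d))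
    (D : ℝ → EuclideanSpace ℝ (Fin d) → ℝ) : Prop :=
  ∀ φ : ℝ × EuclideanSpace ℝ (Fin d) → ℝ, IsTest T φ →
    ∫ z, spaceDeriv φ z (v z.1 z.2) = - ∫ z, D z.1 z.2 * φ z

/-- `G` is the weak spatial gradient of `ψ` on `(0, T) × ℝ^d`. -/
def IsWeakGrad {d : ℕ} (T : ℝ) (ψ : ℝ → EuclideanSpace ℝ (Fin d) → ℝ)
    (G : ℝ → EuclideanSpace ℝ (Fin d) → EuclideanSpace ℝ (Fin d)) : Prop :=
  ∀ φ : ℝ × EuclideanSpace ℝ (Fin d) → ℝ, IsTest T φ → ∀ w : EuclideanSpace ℝ (Fin d),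
    ∫ z, ψ z.1 z.2 * spaceDeriv φ z w = - ∫ z, inner ℝ (G z.1 z.2) w * φ z

/-- The advection field and its divergence are locally in `L^q`. -/
structure IsAdmissibleField {d : ℕ} (q : ℝ≥0∞) (T : ℝ)
    (v : ℝ → EuclideanSpace ℝ (Fin d) → EuclideanSpace ℝ (Fin d)) : Prop where
  memLpLoc : MemLpLoc T q v
  div : ∃ D : ℝ → EuclideanSpace ℝ (Fin d) → ℝ, MemLpLoc T q D ∧ IsWeakDiv T v D

/-- `ψ` is a solution on `[0, T]` of the Cauchy problem
`∂_s ψ + (-Δ)^{α/2} ψ = - div (v ψ)`, `ψ(0) = ψ₀`. -/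
structure IsSolution {d : ℕ} (α : ℝ) (p : ℝ≥0∞) (T : ℝ)
    (v : ℝ → EuclideanSpace ℝ (Fin d) → EuclideanSpace ℝ (Fin d))
    (ψ₀ : EuclideanSpace ℝ (Fin d) → ℝ) (ψ : ℝ → EuclideanSpace ℝ (Fin d) → ℝ) : Prop where
  /-- `ψ ∈ C([0, T]; L¹)`: each time slice is integrable ... -/
  integrable : ∀ s ∈ Set.Icc 0 T, Integrable (ψ s)
  /-- ... and depends continuously on time in the `L¹` norm. -/
  continuous : ∀ s ∈ Set.Icc 0 T,
    Tendsto (fun τ => eLpNorm (ψ τ - ψ s) 1 volume) (𝓝[Set.Icc 0 T] s) (𝓝 0)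
  /-- The initial datum. -/
  initial : ψ 0 =ᵐ[volume] ψ₀
  /-- `ψ` and its weak spatial gradient are locally in `L^p`. -/
  memLpLoc : MemLpLoc T p ψ
  grad : ∃ G : ℝ → EuclideanSpace ℝ (Fin d) → EuclideanSpace ℝ (Fin d),
    MemLpLoc T p G ∧ IsWeakGrad T ψ G
  /-- Mild growth of the flux at infinity: `v ψ / (1 + |x|) ∈ L¹([a, b] × ℝ^d)`. -/
  growth : ∀ a b : ℝ, 0 < a → b < T →
    IntegrableOn
      (fun z : ℝ × EuclideanSpace ℝ (Fin d) => ‖v z.1 z.2‖ * |ψ z.1 z.2| / (1 + ‖z.2‖))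
      (Set.Icc a b ×ˢ Set.univ)
  /-- The equation, in the sense of distributions on `(0, T) × ℝ^d`. -/
  equation : ∀ φ : ℝ × EuclideanSpace ℝ (Fin d) → ℝ, IsTest T φ →
    ∫ z, ψ z.1 z.2 *
      (timeDeriv φ z + spaceDeriv φ z (v z.1 z.2) - fracLaplacian α (fun y => φ (z.1, y)) z.2) = 0

end TransportDiffusion

set_option linter.unusedSectionVars false

/-! Write Λ for the fractional Laplacian. Both claims are one statement about subsolutions: if u is
continuous in time with values in L¹, has the stated local regularity and growth, and satisfies ∂ₛu
+ Λu + div(v u) ≤ 0 against nonnegative test functions, then ∫ u(s) ≤ ∫ u(0)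
(`integral_le_of_subsolution`). It applies to u = ψ and u = -ψ, which gives conservation of mass,
and to u = |ψ|, which gives the L¹ bound.

For that statement, test with θ(s) χ(x/R), θ ≥ 0, and let R → ∞. By scaling, Λ of the cut-off is
O(R^(-α)) uniformly (`abs_fracLaplacian_comp_smul_le`). The gradient of the cut-off is at most a
constant times 1/(1+|x|), uniformly in R, and tends to 0, so the growth assumption on the flux kills
the transport term by dominated convergence. What is left says that the mass has nonpositive
distributional derivative on (0, T); being continuous on [0, T], it stays below its initial value.

That |ψ| is a subsolution is Kato's inequality (`IsSolution.kato`). Since ψ has a weak gradient G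
and v a weak divergence D in conjugate spaces, div(v ψ) = G·v + ψD is a locally integrable function
g, and the equation becomes ∂ₛψ + Λψ = -g. It is renormalized with a smooth convex 1-Lipschitz β
(`integral_renormalized_le`): mollify in space-time, multiply by β'(ψ_k) φ, and let k → ∞. As g is
already a function, no commutator estimate is needed. The diffusion term needs Λβ(ψ) ≤ β'(ψ) Λψ.
This is obtained by writing Λ as a limit of jump operators f ↦ ∫ (f(x) - f(x+y)) κ_n(dy) with finite
κ_n (`exists_generator_approx`), for which it is the convexity inequality β(a) - β(b) ≤ β'(a)(a-b).
The κ_n come from subordination: |ξ|^α is a limit from below of integrals of 1 - exp(-t|ξ|²), and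
exp(-t|ξ|²) is a Gaussian characteristic function.

Finally β(r) = √(r²+δ²) - δ. The chain rule gives β'(ψ)g = div(β(ψ)v) + (ψβ'(ψ) - β(ψ))D, where the
last coefficient is at most δ in absolute value, and δ → 0 gives |ψ|. -/

namespace TransportDiffusion

/-! ### Mollification and its limits in duality pairings -/

section Mollifier

open ContinuousLinearMap Convolution

variable {V : Type*} [NormedAddCommGroup V] [NormedSpace ℝ V] [FiniteDimensional ℝ V]
  [MeasurableSpace V] [BorelSpace V]

/-- A sequence of smooth bump functions concentrating at the origin. -/
noncomputable def bump (V : Type*) [NormedAddCommGroup V] (k : ℕ) : ContDiffBump (0 : V) where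
  rIn := 1 / ((k : ℝ) + 1)
  rOut := 2 / ((k : ℝ) + 1)
  rIn_pos := by positivity
  rIn_lt_rOut := by
    apply div_lt_div_of_pos_right (by norm_num) (by positivity)

/-- The standard mollifier of index `k`. -/
noncomputable def mollifier (μ : Measure V) (k : ℕ) : V → ℝ := (bump V k).normed μ

/-- The mollification of `g`. -/
noncomputable def mollify (μ : Measure V) (k : ℕ) (g : V → ℝ) : V → ℝ :=
  mollifier μ k ⋆[lsmul ℝ ℝ, μ] g

variable (μ : Measure V)

theorem mollify_apply (k : ℕ) (g : V → ℝ) (x : V) :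
    mollify μ k g x = ∫ y, mollifier μ k y * g (x - y) ∂μ := rfl

theorem tendsto_bump_rOut : Tendsto (fun k => (bump V k).rOut) atTop (𝓝 0) := by
  have := (tendsto_one_div_add_atTop_nhds_zero_nat (𝕜 := ℝ)).const_mul 2
  simpa [bump, mul_one_div, div_eq_mul_inv] using this

theorem mollifier_eq_zero [IsLocallyFiniteMeasure μ] [μ.IsOpenPosMeasure] {k : ℕ} {y : V}
    (hy : (bump V k).rOut ≤ ‖y‖) : mollifier μ k y = 0 := by
  by_contra h
  have : y ∈ Function.support ((bump V k).normed μ) := h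
  rw [ContDiffBump.support_normed_eq] at this
  simp at this
  linarith

theorem mollifier_nonneg (k : ℕ) (y : V) : 0 ≤ mollifier μ k y := (bump V k).nonneg_normed y

theorem mollifier_neg (k : ℕ) (y : V) : mollifier μ k (-y) = mollifier μ k y :=
  (bump V k).normed_neg y

theorem contDiff_mollifier (k : ℕ) : ContDiff ℝ ∞ (mollifier μ k) := (bump V k).contDiff_normed

variable [μ.IsAddHaarMeasure]

theorem hasCompactSupport_mollifier (k : ℕ) : HasCompactSupport (mollifier μ k) :=
  (bump V k).hasCompactSupport_normed

theorem integral_mollifier (k : ℕ) : ∫ y, mollifier μ k y ∂μ = 1 := (bump V k).integral_normed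

theorem integrable_mollifier (k : ℕ) : Integrable (mollifier μ k) μ := (bump V k).integrable_normed

theorem lintegral_mollifier (k : ℕ) : ∫⁻ y, ENNReal.ofReal (mollifier μ k y) ∂μ = 1 := by
  rw [← ofReal_integral_eq_lintegral_ofReal (integrable_mollifier μ k)
    (ae_of_all _ (mollifier_nonneg μ k)), integral_mollifier, ENNReal.ofReal_one]

theorem mollify_apply' (k : ℕ) (g : V → ℝ) (x : V) :
    mollify μ k g x = ∫ y, mollifier μ k (x - y) * g y ∂μ := by
  rw [mollify, convolution_eq_swap]; rfl

variable {μ} {g : V → ℝ}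

theorem contDiff_mollify (hg : LocallyIntegrable g μ) (k : ℕ) : ContDiff ℝ ∞ (mollify μ k g) :=
  (hasCompactSupport_mollifier μ k).contDiff_convolution_left _ (contDiff_mollifier μ k) hg

theorem hasCompactSupport_mollify (hg : HasCompactSupport g) (k : ℕ) :
    HasCompactSupport (mollify μ k g) :=
  (hasCompactSupport_mollifier μ k).convolution _ hg

theorem ae_tendsto_mollify (hg : LocallyIntegrable g μ) :
    ∀ᵐ x ∂μ, Tendsto (fun k => mollify μ k g x) atTop (𝓝 (g x)) := by
  -- Lebesgue differentiation requires rOut ≤ K * rIn; for these bumps the ratio is exactly 2.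
  refine ContDiffBump.ae_convolution_tendsto_right_of_locallyIntegrable (K := 2)
    tendsto_bump_rOut (Eventually.of_forall fun k => ?_) hg
  simp [bump, div_eq_mul_inv]

theorem integrable_mollifier_mul (hg : LocallyIntegrable g μ) (k : ℕ) (x : V) :
    Integrable (fun y => mollifier μ k (x - y) * g y) μ := by
  have h1 : HasCompactSupport fun y => mollifier μ k (x - y) :=
    (hasCompactSupport_mollifier μ k).comp_homeomorph (Homeomorph.subLeft x)
  have h2 : Continuous fun y => mollifier μ k (x - y) :=
    (contDiff_mollifier μ k).continuous.comp (by fun_prop)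
  exact hg.integrable_smul_left_of_hasCompactSupport h2 h1

theorem enorm_mollify_sub_le (hg : LocallyIntegrable g μ) (k : ℕ) (x : V) :
    ‖mollify μ k g x - g x‖ₑ ≤
      ∫⁻ y, ENNReal.ofReal (mollifier μ k y) * ‖g (x - y) - g x‖ₑ ∂μ := by
  have hi : Integrable (fun y => mollifier μ k y * g (x - y)) μ := by
    have := (integrable_mollifier_mul hg k x).comp_sub_left x
    simpa using this
  have : mollify μ k g x - g x = ∫ y, mollifier μ k y * (g (x - y) - g x) ∂μ := by
    simp_rw [mul_sub]
    rw [integral_sub hi ((integrable_mollifier μ k).mul_const _), integral_mul_const,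
      integral_mollifier, one_mul, mollify_apply]
  rw [this]
  refine (enorm_integral_le_lintegral_enorm _).trans (lintegral_mono fun y => ?_)
  rw [enorm_mul, Real.enorm_of_nonneg (mollifier_nonneg μ k y)]

theorem tendsto_eLpNorm_translate {p : ℝ≥0∞} (hp1 : 1 ≤ p) (hp : p ≠ ⊤) (hg : MemLp g p μ) :
    Tendsto (fun h : V => eLpNorm (fun x => g (x - h) - g x) p μ) (𝓝 0) (𝓝 0) := by
  have : Fact (1 ≤ p) := ⟨hp1⟩
  have : Fact (p ≠ ⊤) := ⟨hp⟩
  have hc : Continuous fun h : V => (DomAddAct.mk (-h)) +ᵥ hg.toLp g :=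
    (DomAddAct.continuous_mk.comp continuous_neg).vadd continuous_const
  have := (hc.tendsto 0).edist (tendsto_const_nhds (x := hg.toLp g))
  simp only [neg_zero, DomAddAct.mk_zero, zero_vadd, edist_self] at this
  refine this.congr fun h => ?_
  rw [DomAddAct.mk_vadd_toLp, Lp.edist_toLp_toLp]
  congr 1; ext x; simp [sub_eq_neg_add]

/-- All conjugate pairs are covered, at the price of two arguments. For p < ∞, Fubini and Hölder
reduce to continuity of translations in L^p. For p = ∞ mollification need not converge in norm, but
f is in L¹, the mollifications are bounded by the norm of g, and a.e. convergence suffices. -/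
theorem tendsto_lintegral_mollify_sub {p q : ℝ≥0∞} (hpq : ENNReal.HolderConjugate p q)
    {f : V → ℝ} (hf : MemLp f q μ) (hg : MemLp g p μ) :
    Tendsto (fun k => ∫⁻ x, ‖f x‖ₑ * ‖mollify μ k g x - g x‖ₑ ∂μ) atTop (𝓝 0) := by
  have hp1 : 1 ≤ p := hpq.one_le
  have hgl : LocallyIntegrable g μ := hg.locallyIntegrable hp1
  by_cases hp : p = ⊤
  · subst hp
    obtain rfl : q = 1 := by
      have := hpq.symm.inv_add_inv_eq_one
      simpa using this
    have hb : ∀ᵐ x ∂μ, ‖g x‖ₑ ≤ eLpNorm g ⊤ μ := by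
      simpa [eLpNorm_exponent_top] using ae_le_eLpNormEssSup
    have hbm : ∀ k x, ‖mollify μ k g x‖ₑ ≤ eLpNorm g ⊤ μ := by
      intro k x
      rw [mollify_apply']
      refine (enorm_integral_le_lintegral_enorm _).trans ?_
      calc ∫⁻ y, ‖mollifier μ k (x - y) * g y‖ₑ ∂μ
          ≤ ∫⁻ y, ENNReal.ofReal (mollifier μ k (x - y)) * eLpNorm g ⊤ μ ∂μ := by
            refine lintegral_mono_ae ?_
            filter_upwards [hb] with y hy
            rw [enorm_mul, Real.enorm_of_nonneg (mollifier_nonneg μ k _)]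
            gcongr
        _ = eLpNorm g ⊤ μ := by
            rw [lintegral_mul_const' _ _ hg.eLpNorm_ne_top,
              lintegral_sub_left_eq_self (fun y => ENNReal.ofReal (mollifier μ k y)) x,
              lintegral_mollifier, one_mul]
    have h0 : ∫⁻ x, 0 ∂μ = 0 := by simp
    rw [← h0]
    refine tendsto_lintegral_of_dominated_convergence'
      (fun x => ‖f x‖ₑ * (eLpNorm g ⊤ μ + eLpNorm g ⊤ μ)) (fun k => ?_) (fun k => ?_) ?_ ?_
    · exact hf.1.enorm.mul (((contDiff_mollify hgl k).continuous.aestronglyMeasurable.sub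
        hg.1).enorm)
    · filter_upwards [hb] with x hx
      gcongr
      exact (enorm_sub_le).trans (add_le_add (hbm k x) hx)
    · rw [lintegral_mul_const' _ _ (ENNReal.add_ne_top.2 ⟨hg.2.ne, hg.2.ne⟩)]
      have := hf.eLpNorm_ne_top
      rw [eLpNorm_one_eq_lintegral_enorm] at this
      exact ENNReal.mul_ne_top this (ENNReal.add_ne_top.2 ⟨hg.2.ne, hg.2.ne⟩)
    · filter_upwards [ae_tendsto_mollify hgl] with x hx
      have h1 : Tendsto (fun k => ‖mollify μ k g x - g x‖ₑ) atTop (𝓝 0) := by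
        have := (hx.sub_const (g x)).enorm
        simpa using this
      simpa using ENNReal.Tendsto.const_mul h1 (Or.inr enorm_ne_top)
  · have ht := tendsto_eLpNorm_translate hp1 hp hg
    rw [ENNReal.tendsto_nhds_zero]
    intro ε hε
    obtain ⟨η, hη, hηε⟩ : ∃ η : ℝ≥0∞, 0 < η ∧ eLpNorm f q μ * η ≤ ε := by
      by_cases hε' : ε = ⊤
      · exact ⟨1, one_pos, by simp [hε']⟩
      refine ⟨ε / (eLpNorm f q μ + 1), ENNReal.div_pos hε.ne' (by simp [hf.eLpNorm_ne_top]), ?_⟩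
      calc eLpNorm f q μ * (ε / (eLpNorm f q μ + 1))
          ≤ (eLpNorm f q μ + 1) * (ε / (eLpNorm f q μ + 1)) := by gcongr; simp
        _ = ε := ENNReal.mul_div_cancel (by simp) (by simp [hf.eLpNorm_ne_top])
    obtain ⟨r, hr, hball⟩ := Metric.eventually_nhds_iff.1 (ENNReal.tendsto_nhds_zero.1 ht η hη)
    filter_upwards [(tendsto_bump_rOut (V := V)).eventually (gt_mem_nhds hr)] with k hk
    have hmeas : AEMeasurable (Function.uncurry fun x y =>
        ‖f x‖ₑ * (ENNReal.ofReal (mollifier μ k y) * ‖g (x - y) - g x‖ₑ)) (μ.prod μ) := by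
      refine AEMeasurable.mul hf.1.comp_fst.enorm (AEMeasurable.mul (f := fun z : V × V => ENNReal.ofReal (mollifier μ k z.2)) (g := fun z : V × V => ‖g (z.1 - z.2) - g z.1‖ₑ) ?_ ?_)
      · exact ((contDiff_mollifier μ k).continuous.measurable.comp measurable_snd).ennreal_ofReal.aemeasurable
      · exact ((hg.1.comp_quasiMeasurePreserving (quasiMeasurePreserving_sub μ μ)).sub hg.1.comp_fst).enorm
    calc ∫⁻ x, ‖f x‖ₑ * ‖mollify μ k g x - g x‖ₑ ∂μ
        ≤ ∫⁻ x, ∫⁻ y, ‖f x‖ₑ * (ENNReal.ofReal (mollifier μ k y) * ‖g (x - y) - g x‖ₑ) ∂μ ∂μ := by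
          refine lintegral_mono fun x => ?_
          rw [lintegral_const_mul' _ _ enorm_ne_top]
          gcongr
          exact enorm_mollify_sub_le hgl k x
      _ = ∫⁻ y, ∫⁻ x, ‖f x‖ₑ * (ENNReal.ofReal (mollifier μ k y) * ‖g (x - y) - g x‖ₑ) ∂μ ∂μ :=
          lintegral_lintegral_swap hmeas
      _ ≤ ∫⁻ y, ENNReal.ofReal (mollifier μ k y) * ε ∂μ := by
          refine lintegral_mono fun y => ?_
          rcases le_or_gt (bump V k).rOut ‖y‖ with hy | hy
          · simp [mollifier_eq_zero μ hy]
          calc ∫⁻ x, ‖f x‖ₑ * (ENNReal.ofReal (mollifier μ k y) * ‖g (x - y) - g x‖ₑ) ∂μ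
              = ENNReal.ofReal (mollifier μ k y) * ∫⁻ x, ‖f x * (g (x - y) - g x)‖ₑ ∂μ := by
                rw [← lintegral_const_mul' _ _ ENNReal.ofReal_ne_top]
                congr 1; ext x; rw [enorm_mul]; ring
            _ ≤ ENNReal.ofReal (mollifier μ k y) * ε := by
                gcongr
                rw [← eLpNorm_one_eq_lintegral_enorm]
                have := hpq.symm
                have hg' : AEStronglyMeasurable (fun x => g (x - y) - g x) μ :=
                  (hg.1.comp_quasiMeasurePreserving
                    (measurePreserving_sub_right μ y).quasiMeasurePreserving).sub hg.1
                refine (eLpNorm_smul_le_mul_eLpNorm (p := q) (q := p) (r := 1) hg' hf.1).trans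
                  (le_trans ?_ hηε)
                gcongr
                exact hball (by simpa using hy.trans hk)
      _ = ε := by
          rw [lintegral_mul_const _ (contDiff_mollifier μ k).continuous.measurable.ennreal_ofReal,
            lintegral_mollifier, one_mul]

/-- The Lipschitz bound dominates the difference of integrands by |f| |g_k - g|. Integrability holds
eventually because that difference has a small L¹ norm. -/
theorem tendsto_integral_mul_lipschitz_mollify {p q : ℝ≥0∞} (hpq : ENNReal.HolderConjugate p q)
    {f : V → ℝ} (hf : MemLp f q μ) (hg : MemLp g p μ) {β : ℝ → ℝ} (hβ : LipschitzWith 1 β)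
    (hβ0 : β 0 = 0) :
    (∀ᶠ k in atTop, Integrable (fun x => f x * β (mollify μ k g x)) μ) ∧
      Tendsto (fun k => ∫ x, f x * β (mollify μ k g x) ∂μ) atTop (𝓝 (∫ x, f x * β (g x) ∂μ)) := by
  have hgl : LocallyIntegrable g μ := hg.locallyIntegrable hpq.one_le
  have hβg : MemLp (fun x => β (g x)) p μ := by
    refine hg.of_le (hβ.continuous.comp_aestronglyMeasurable hg.1) (ae_of_all _ fun x => ?_)
    have := hβ.dist_le_mul (g x) 0
    simpa [hβ0] using this
  have hi : Integrable (fun x => f x * β (g x)) μ :=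
    have := hpq.symm
    hf.integrable_mul hβg
  have hm : ∀ k, AEStronglyMeasurable (fun x => f x * β (mollify μ k g x)) μ := fun k =>
    hf.1.mul (hβ.continuous.comp (contDiff_mollify hgl k).continuous).aestronglyMeasurable
  have hle : ∀ k, ∫⁻ x, ‖f x * β (mollify μ k g x) - f x * β (g x)‖ₑ ∂μ ≤
      ∫⁻ x, ‖f x‖ₑ * ‖mollify μ k g x - g x‖ₑ ∂μ := by
    intro k
    refine lintegral_mono fun x => ?_
    rw [← mul_sub, enorm_mul]
    gcongr
    have := hβ.edist_le_mul (mollify μ k g x) (g x)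
    simpa [edist_eq_enorm_sub] using this
  have ht := tendsto_lintegral_mollify_sub hpq hf hg
  have ht' := tendsto_of_tendsto_of_tendsto_of_le_of_le tendsto_const_nhds ht (fun _ => zero_le) hle
  have hev : ∀ᶠ k in atTop, Integrable (fun x => f x * β (mollify μ k g x)) μ := by
    filter_upwards [ht'.eventually (gt_mem_nhds zero_lt_one)] with k hk
    have : Integrable (fun x => f x * β (mollify μ k g x) - f x * β (g x)) μ :=
      ⟨(hm k).sub hi.1, hk.trans ENNReal.one_lt_top⟩
    exact (this.add hi).congr (ae_of_all _ fun x => by simp)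
  exact ⟨hev, tendsto_integral_of_L1 _ hi.1 hev ht'⟩

/-- Replacing the mollified g by g costs at most C ∫ |f| |g_k - g|; the remaining factor b_k is
handled by dominated convergence against C |f g|. In the applications b_k is β' of a mollification.
-/
theorem tendsto_integral_mul_mul_mollify {p q : ℝ≥0∞} (hpq : ENNReal.HolderConjugate p q)
    {f : V → ℝ} (hf : MemLp f q μ) (hg : MemLp g p μ) {b : ℕ → V → ℝ} {b' : V → ℝ} {C : ℝ}
    (hbm : ∀ k, AEStronglyMeasurable (b k) μ) (hbC : ∀ k x, |b k x| ≤ C)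
    (hb : ∀ᵐ x ∂μ, Tendsto (fun k => b k x) atTop (𝓝 (b' x))) :
    (∀ᶠ k in atTop, Integrable (fun x => f x * b k x * mollify μ k g x) μ) ∧
      Tendsto (fun k => ∫ x, f x * b k x * mollify μ k g x ∂μ) atTop
        (𝓝 (∫ x, f x * b' x * g x ∂μ)) := by
  have hgl : LocallyIntegrable g μ := hg.locallyIntegrable hpq.one_le
  have hfg : Integrable (fun x => f x * g x) μ :=
    have := hpq.symm
    hf.integrable_mul hg
  have hfb : ∀ k, Integrable (fun x => f x * g x * b k x) μ := fun k =>
    hfg.mul_bdd (hbm k) (ae_of_all _ (hbC k))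
  have hm : ∀ k, AEStronglyMeasurable
      (fun x => f x * b k x * mollify μ k g x - f x * g x * b k x) μ := fun k =>
    ((hf.1.mul (hbm k)).mul (contDiff_mollify hgl k).continuous.aestronglyMeasurable).sub (hfb k).1
  have hle : ∀ k, ∫⁻ x, ‖f x * b k x * mollify μ k g x - f x * g x * b k x‖ₑ ∂μ ≤
      ENNReal.ofReal C * ∫⁻ x, ‖f x‖ₑ * ‖mollify μ k g x - g x‖ₑ ∂μ := by
    intro k
    rw [← lintegral_const_mul' _ _ ENNReal.ofReal_ne_top]
    refine lintegral_mono fun x => ?_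
    have : f x * b k x * mollify μ k g x - f x * g x * b k x =
      b k x * (f x * (mollify μ k g x - g x)) := by ring
    rw [this, enorm_mul, enorm_mul]
    gcongr
    rw [Real.enorm_eq_ofReal_abs]
    exact ENNReal.ofReal_le_ofReal (hbC k x)
  have ht := ENNReal.Tendsto.const_mul (a := ENNReal.ofReal C)
    (tendsto_lintegral_mollify_sub hpq hf hg) (Or.inr ENNReal.ofReal_ne_top)
  rw [mul_zero] at ht
  have ht' := tendsto_of_tendsto_of_tendsto_of_le_of_le tendsto_const_nhds ht (fun _ => zero_le) hle
  have hd : ∀ᶠ k in atTop,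
      Integrable (fun x => f x * b k x * mollify μ k g x - f x * g x * b k x) μ := by
    filter_upwards [ht'.eventually (gt_mem_nhds zero_lt_one)] with k hk
    exact ⟨hm k, hk.trans ENNReal.one_lt_top⟩
  have hev : ∀ᶠ k in atTop, Integrable (fun x => f x * b k x * mollify μ k g x) μ := by
    filter_upwards [hd] with k hk
    exact (hk.add (hfb k)).congr (ae_of_all _ fun x => by simp)
  refine ⟨hev, ?_⟩
  have h1 : Tendsto (fun k => ∫ x, (f x * b k x * mollify μ k g x - f x * g x * b k x) ∂μ) atTop
      (𝓝 (∫ x, (0 : ℝ) ∂μ)) :=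
    tendsto_integral_of_L1 (fun _ => (0 : ℝ)) aestronglyMeasurable_const hd (by simpa using ht')
  have h2 : Tendsto (fun k => ∫ x, f x * g x * b k x ∂μ) atTop (𝓝 (∫ x, f x * g x * b' x ∂μ)) := by
    refine tendsto_integral_of_dominated_convergence (fun x => |f x * g x| * C)
      (fun k => (hfb k).1) (hfg.abs.mul_const C) (fun k => ae_of_all _ fun x => ?_) ?_
    · rw [Real.norm_eq_abs, abs_mul]
      gcongr
      exact hbC k x
    · filter_upwards [hb] with x hx using hx.const_mul _
  have h3 := h1.add h2
  simp only [integral_zero, zero_add] at h3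
  have h4 : ∀ x, f x * b' x * g x = f x * g x * b' x := fun x => by ring
  simp_rw [h4]
  refine h3.congr' ?_
  filter_upwards [hev] with k hk
  rw [integral_sub hk (hfb k), sub_add_cancel]

theorem integrable_mollify (hg : Integrable g μ) (k : ℕ) : Integrable (mollify μ k g) μ :=
  (integrable_mollifier μ k).integrable_convolution _ hg

theorem abs_mollify_le {C : ℝ} (hC : ∀ x, |g x| ≤ C) (k : ℕ) (x : V) : |mollify μ k g x| ≤ C := by
  rw [mollify_apply, ← Real.norm_eq_abs]
  calc ‖∫ y, mollifier μ k y * g (x - y) ∂μ‖ ≤ ∫ y, mollifier μ k y * C ∂μ := by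
        refine norm_integral_le_of_norm_le ((integrable_mollifier μ k).mul_const C)
          (ae_of_all _ fun y => ?_)
        rw [Real.norm_eq_abs, abs_mul, abs_of_nonneg (mollifier_nonneg μ k y)]
        exact mul_le_mul_of_nonneg_left (hC _) (mollifier_nonneg μ k y)
    _ = C := by rw [integral_mul_const, integral_mollifier, one_mul]

theorem mollify_add_right (k : ℕ) (h : V → ℝ) (w x : V) :
    mollify μ k h (x + w) = mollify μ k (fun y => h (y + w)) x := by
  simp_rw [mollify_apply]
  congr 1; ext y; congr 2; abel

theorem mollify_congr {k : ℕ} {h : V → ℝ} {x : V}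
    (H : ∀ y ∈ Metric.closedBall x (bump V k).rOut, g y = h y) :
    mollify μ k g x = mollify μ k h x := by
  simp_rw [mollify_apply]
  congr 1; ext y
  rcases le_or_gt (bump V k).rOut ‖y‖ with hy | hy
  · simp [mollifier_eq_zero μ hy]
  · rw [H]; simpa using hy.le

theorem tsupport_mollify_subset (k : ℕ) (h : V → ℝ) :
    tsupport (mollify μ k h) ⊆ Metric.cthickening (bump V k).rOut (tsupport h) := by
  refine closure_minimal (fun x hx => ?_) Metric.isClosed_cthickening
  by_contra hx'
  refine hx ?_
  rw [mollify_congr (h := 0) (μ := μ) (fun y hy => ?_)]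
  · simp [mollify_apply]
  · by_contra hy'
    refine hx' (Metric.mem_cthickening_of_dist_le x y _ _ (subset_tsupport _ hy') ?_)
    rwa [dist_comm]

/-- The mollifier is even, so mollification is symmetric for the L² pairing. -/
theorem integral_mul_mollify {f h : V → ℝ} (hf : Integrable f μ) (hh : Integrable h μ) (k : ℕ) :
    ∫ x, f x * mollify μ k h x ∂μ = ∫ x, mollify μ k f x * h x ∂μ := by
  obtain ⟨C, hC⟩ := (contDiff_mollifier μ k).continuous.bounded_above_of_compact_support
    (hasCompactSupport_mollifier μ k)
  have hi : Integrable (fun z : V × V => f z.1 * h z.2 * mollifier μ k (z.1 - z.2)) (μ.prod μ) := by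
    refine (hf.mul_prod hh).mul_bdd ?_ (ae_of_all _ fun z => hC _)
    exact ((contDiff_mollifier μ k).continuous.comp (by fun_prop)).aestronglyMeasurable
  calc ∫ x, f x * mollify μ k h x ∂μ
      = ∫ x, ∫ y, f x * h y * mollifier μ k (x - y) ∂μ ∂μ := by
        congr 1; ext x
        rw [mollify_apply', ← integral_const_mul]
        congr 1; ext y; ring
    _ = ∫ y, ∫ x, f x * h y * mollifier μ k (x - y) ∂μ ∂μ := integral_integral_swap hi
    _ = ∫ x, mollify μ k f x * h x ∂μ := by
        congr 1; ext y
        rw [mollify_apply', ← integral_mul_const]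
        congr 1; ext x
        rw [← mollifier_neg μ k (x - y), neg_sub]; ring

theorem fderiv_mollify_eq_mollify_fderiv {h : V → ℝ} (hh : ContDiff ℝ 1 h)
    (hc : HasCompactSupport h) (k : ℕ) (x w : V) :
    fderiv ℝ (mollify μ k h) x w = mollify μ k (fun y => fderiv ℝ h y w) x := by
  have hl : LocallyIntegrable (mollifier μ k) μ := (integrable_mollifier μ k).locallyIntegrable
  rw [mollify, (hc.hasFDerivAt_convolution_right _ hl hh x).fderiv,
    convolution_precompR_apply _ hl (hc.fderiv ℝ) (hh.continuous_fderiv one_ne_zero)]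
  rfl

/-- The weak derivative identity is assumed only for the single test function y ↦ ρ_k(x - y), so the
lemma applies to fields whose weak derivative is known only near x. -/
theorem fderiv_mollify_eq_of_weak {G : V → ℝ} (hg : LocallyIntegrable g μ) {k : ℕ} {x w : V}
    (h : ∫ y, g y * fderiv ℝ (fun y => mollifier μ k (x - y)) y w ∂μ =
      -∫ y, G y * mollifier μ k (x - y) ∂μ) :
    fderiv ℝ (mollify μ k g) x w = mollify μ k G x := by
  have hd : ∀ y, fderiv ℝ (fun y => mollifier μ k (x - y)) y w =
      -(fderiv ℝ (mollifier μ k) (x - y) w) := fun y => by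
    have h1 := ((contDiff_mollifier μ k).differentiable (by simp) (x - y)).hasFDerivAt
    have h2 : HasFDerivAt (fun y => x - y) (-ContinuousLinearMap.id ℝ V) y :=
      (hasFDerivAt_id y).const_sub x
    rw [show (fun y => mollifier μ k (x - y)) = mollifier μ k ∘ fun y => x - y from rfl,
      (h1.comp y h2).fderiv]
    simp
  have hs := (contDiff_mollifier μ k).of_le (m := 1) (by simp)
  have h1 : fderiv ℝ (mollify μ k g) x w = ∫ y, fderiv ℝ (mollifier μ k) (x - y) w * g y ∂μ := by
    rw [mollify, ((hasCompactSupport_mollifier μ k).hasFDerivAt_convolution_left _ hs hg x).fderiv,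
      convolution_eq_swap, ContinuousLinearMap.integral_apply]
    · rfl
    · have h2 : HasCompactSupport fun y => fderiv ℝ (mollifier μ k) (x - y) :=
        ((hasCompactSupport_mollifier μ k).fderiv ℝ).comp_homeomorph (Homeomorph.subLeft x)
      have h3 : Continuous fun y => fderiv ℝ (mollifier μ k) (x - y) :=
        (hs.continuous_fderiv one_ne_zero).comp (by fun_prop)
      have := hg.integrable_smul_right_of_hasCompactSupport h3 h2
      refine this.congr (ae_of_all _ fun y => ?_)
      ext; simp [precompL_apply, mul_comm]
  simp_rw [hd, mul_neg, integral_neg, neg_inj] at h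
  rw [h1, mollify_apply']
  simp_rw [mul_comm (mollifier μ k _), ← h, mul_comm (g _)]

end Mollifier

/-! ### Subordination: the symbol as a limit of compound Poisson symbols -/

section Subordination

theorem one_sub_exp_neg_nonneg {x : ℝ} (hx : 0 ≤ x) : 0 ≤ 1 - Real.exp (-x) := by
  have := Real.exp_le_one_iff.2 (neg_nonpos.2 hx)
  linarith

theorem one_sub_exp_neg_le (x : ℝ) : 1 - Real.exp (-x) ≤ x := by
  have := Real.add_one_le_exp (-x)
  linarith

/-- Near 0 the bound 1 - exp(-t) ≤ t leaves t^(-s), integrable as s < 1; beyond 1 the factor is at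
most 1 and t^(-1-s) is integrable as s > 0. -/
theorem integrableOn_one_sub_exp_mul_rpow {s : ℝ} (hs : 0 < s) (hs1 : s < 1) :
    IntegrableOn (fun t : ℝ => (1 - Real.exp (-t)) * t ^ (-1 - s)) (Set.Ioi 0) := by
  rw [← Set.Ioc_union_Ioi_eq_Ioi zero_le_one]
  have hm : Measurable fun t : ℝ => (1 - Real.exp (-t)) * t ^ (-1 - s) := by fun_prop
  refine IntegrableOn.union ?_ ?_
  · have h1 : IntegrableOn (fun t : ℝ => t ^ (-s)) (Set.Ioc 0 1) := by
      rw [← intervalIntegrable_iff_integrableOn_Ioc_of_le zero_le_one]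
      exact intervalIntegral.intervalIntegrable_rpow' (by linarith)
    refine Integrable.mono' h1 hm.aestronglyMeasurable ?_
    filter_upwards [ae_restrict_mem measurableSet_Ioc] with t ht
    have ht0 : 0 < t := ht.1
    rw [Real.norm_eq_abs, abs_of_nonneg
      (mul_nonneg (one_sub_exp_neg_nonneg ht0.le) (Real.rpow_nonneg ht0.le _))]
    calc (1 - Real.exp (-t)) * t ^ (-1 - s) ≤ t * t ^ (-1 - s) := by
          gcongr
          exact one_sub_exp_neg_le t
      _ = t ^ (-s) := by
          rw [← Real.rpow_one_add' ht0.le (by linarith)]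
          congr 1; ring
  · refine Integrable.mono' (integrableOn_Ioi_rpow_of_lt (a := -1 - s) (by linarith) zero_lt_one)
      hm.aestronglyMeasurable ?_
    filter_upwards [ae_restrict_mem measurableSet_Ioi] with t ht
    have ht0 : 0 < t := zero_lt_one.trans ht
    rw [Real.norm_eq_abs, abs_of_nonneg
      (mul_nonneg (one_sub_exp_neg_nonneg ht0.le) (Real.rpow_nonneg ht0.le _))]
    refine mul_le_of_le_one_left (Real.rpow_nonneg ht0.le _) ?_
    linarith [Real.exp_pos (-t)]

theorem integral_one_sub_exp_mul_rpow_pos {s : ℝ} (hs : 0 < s) (hs1 : s < 1) :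
    0 < ∫ t in Set.Ioi (0 : ℝ), (1 - Real.exp (-t)) * t ^ (-1 - s) := by
  rw [setIntegral_pos_iff_support_of_nonneg_ae _ (integrableOn_one_sub_exp_mul_rpow hs hs1)]
  · have : Set.Ioi (0 : ℝ) ⊆ (Function.support fun t : ℝ => (1 - Real.exp (-t)) * t ^ (-1 - s)) ∩
        Set.Ioi 0 := by
      intro t ht
      refine ⟨(mul_pos ?_ (Real.rpow_pos_of_pos ht _)).ne', ht⟩
      have := Real.exp_lt_one_iff.2 (neg_lt_zero.2 ht)
      linarith
    refine lt_of_lt_of_le ?_ (measure_mono this)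
    simp
  · filter_upwards [ae_restrict_mem measurableSet_Ioi] with t ht
    exact mul_nonneg (one_sub_exp_neg_nonneg (le_of_lt ht)) (Real.rpow_nonneg (le_of_lt ht) _)

theorem integral_one_sub_exp_scale {s l : ℝ} (hs : 0 < s) (hs1 : s < 1) (hl : 0 < l) :
    IntegrableOn (fun t : ℝ => (1 - Real.exp (-(t * l))) * t ^ (-1 - s)) (Set.Ioi 0) ∧
    ∫ t in Set.Ioi (0 : ℝ), (1 - Real.exp (-(t * l))) * t ^ (-1 - s) =
      l ^ s * ∫ t in Set.Ioi (0 : ℝ), (1 - Real.exp (-t)) * t ^ (-1 - s) := by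
  have he : Set.EqOn (fun t : ℝ => (1 - Real.exp (-(t * l))) * t ^ (-1 - s))
      (fun t => l ^ (1 + s) * ((1 - Real.exp (-(l * t))) * (l * t) ^ (-1 - s))) (Set.Ioi 0) := by
    intro t ht
    have ht : 0 < t := ht
    have h1 : l ^ (1 + s) * l ^ (-1 - s) = 1 := by
      rw [← Real.rpow_add hl]; ring_nf; simp
    simp only
    rw [Real.mul_rpow hl.le ht.le, mul_comm t l]
    linear_combination (-(1 - Real.exp (-(l * t))) * t ^ (-1 - s)) * h1
  have hi := (integrableOn_Ioi_comp_mul_left_iff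
    (fun t : ℝ => (1 - Real.exp (-t)) * t ^ (-1 - s)) 0 hl).2
      (by simpa using integrableOn_one_sub_exp_mul_rpow hs hs1)
  refine ⟨(integrableOn_congr_fun he measurableSet_Ioi).2 (hi.const_mul _), ?_⟩
  rw [setIntegral_congr_fun measurableSet_Ioi he, integral_const_mul,
    integral_comp_mul_left_Ioi (fun t : ℝ => (1 - Real.exp (-t)) * t ^ (-1 - s)) 0 hl, mul_zero,
    smul_eq_mul, ← mul_assoc]
  congr 1
  rw [Real.rpow_add hl, Real.rpow_one]
  field_simp

/-- The function `l ↦ l ^ s`, for `0 < s ≤ 1`, is a limit from below of Bernstein functions with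
finite Lévy measure. -/
theorem exists_levy_measure {s : ℝ} (hs : 0 < s) (hs1 : s ≤ 1) :
    ∃ ν : ℕ → Measure ℝ, (∀ n, IsFiniteMeasure (ν n)) ∧ (∀ n, ∀ᵐ t ∂ν n, 0 ≤ t) ∧
      (∀ n l, 0 ≤ l → ∫ t, (1 - Real.exp (-(t * l))) ∂ν n ≤ l ^ s) ∧
      ∀ l, 0 ≤ l → Tendsto (fun n => ∫ t, (1 - Real.exp (-(t * l))) ∂ν n) atTop (𝓝 (l ^ s)) := by
  rcases hs1.eq_or_lt with rfl | hs1
  -- For s = 1 there is no Lévy density. The measure (n+1) δ at 1/(n+1) makes the integral a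
  -- difference quotient at 0 of x ↦ 1 - exp(-x l), whose derivative there is l.
  · refine ⟨fun n => ENNReal.ofReal ((n : ℝ) + 1) • Measure.dirac (1 / ((n : ℝ) + 1)),
      fun n => ?_, fun n => ?_, fun n l hl => ?_, fun l hl => ?_⟩
    · constructor; simp
    · refine Measure.ae_smul_measure ?_ _
      rw [ae_dirac_iff measurableSet_Ici]
      positivity
    · rw [integral_smul_measure, integral_dirac, ENNReal.toReal_ofReal (by positivity),
        Real.rpow_one, smul_eq_mul]
      have hn : (0 : ℝ) < (n : ℝ) + 1 := by positivity
      calc ((n : ℝ) + 1) * (1 - Real.exp (-(1 / ((n : ℝ) + 1) * l)))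
          ≤ ((n : ℝ) + 1) * (1 / ((n : ℝ) + 1) * l) := by
            gcongr; exact one_sub_exp_neg_le _
        _ = l := by field_simp
    · simp_rw [integral_smul_measure, integral_dirac, Real.rpow_one, smul_eq_mul]
      have hd : HasDerivAt (fun x : ℝ => 1 - Real.exp (-(x * l))) l 0 := by
        have := (((hasDerivAt_id (0 : ℝ)).mul_const l).neg.exp).const_sub 1
        simpa using this
      have h1 := hd.tendsto_slope_zero_right
      have h2 : Tendsto (fun n : ℕ => 1 / ((n : ℝ) + 1)) atTop (𝓝[>] 0) :=
        tendsto_nhdsWithin_iff.2 ⟨tendsto_one_div_add_atTop_nhds_zero_nat,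
          Eventually.of_forall fun n => by simp only [Set.mem_Ioi]; positivity⟩
      refine (h1.comp h2).congr fun n => ?_
      rw [ENNReal.toReal_ofReal (by positivity)]
      simp
  -- For s < 1 the Lévy density t^(-1-s)/c is cut off below 1/(n+1), which makes the measure finite;
  -- the integrands are nonnegative, so the truncated integrals approach l^s from below.
  · set c := ∫ t in Set.Ioi (0 : ℝ), (1 - Real.exp (-t)) * t ^ (-1 - s) with hc
    have hc0 : 0 < c := integral_one_sub_exp_mul_rpow_pos hs hs1
    have hmeas : Measurable fun t : ℝ => ENNReal.ofReal (c⁻¹ * t ^ (-1 - s)) := by fun_prop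
    have hsub : ∀ n : ℕ, Set.Ioi (1 / ((n : ℝ) + 1)) ⊆ Set.Ioi 0 := fun n =>
      Set.Ioi_subset_Ioi (by positivity)
    have hint : ∀ (n : ℕ) (l : ℝ), ∫ t, (1 - Real.exp (-(t * l)))
        ∂((volume.restrict (Set.Ioi (1 / ((n : ℝ) + 1)))).withDensity
          fun t => ENNReal.ofReal (c⁻¹ * t ^ (-1 - s))) =
        c⁻¹ * ∫ t in Set.Ioi (1 / ((n : ℝ) + 1)), (1 - Real.exp (-(t * l))) * t ^ (-1 - s) := by
      intro n l
      rw [integral_withDensity_eq_integral_toReal_smul hmeas (ae_of_all _ fun _ => by simp),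
        ← integral_const_mul]
      refine setIntegral_congr_fun measurableSet_Ioi fun t ht => ?_
      have ht : 0 < t := hsub n ht
      simp only [smul_eq_mul]
      rw [ENNReal.toReal_ofReal (mul_nonneg (inv_nonneg.2 hc0.le) (Real.rpow_nonneg ht.le _))]
      ring
    refine ⟨fun n => (volume.restrict (Set.Ioi (1 / ((n : ℝ) + 1)))).withDensity
      fun t => ENNReal.ofReal (c⁻¹ * t ^ (-1 - s)), fun n => ?_, fun n => ?_, fun n l hl => ?_,
      fun l hl => ?_⟩
    · exact isFiniteMeasure_withDensity_ofReal
        ((integrableOn_Ioi_rpow_of_lt (a := -1 - s) (by linarith)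
          (c := 1 / ((n : ℝ) + 1)) (by positivity)).const_mul c⁻¹).2
    · refine (withDensity_absolutelyContinuous _ _).ae_le ?_
      filter_upwards [ae_restrict_mem measurableSet_Ioi] with t ht using (hsub n ht).le
    · rw [hint]
      rcases hl.eq_or_lt with rfl | hl
      · simp [Real.zero_rpow hs.ne']
      obtain ⟨hi, he⟩ := integral_one_sub_exp_scale hs hs1 hl
      calc _ ≤ c⁻¹ * ∫ t in Set.Ioi (0 : ℝ), (1 - Real.exp (-(t * l))) * t ^ (-1 - s) := by
            refine mul_le_mul_of_nonneg_left
              (setIntegral_mono_set hi ?_ (hsub n).eventuallyLE) (inv_nonneg.2 hc0.le)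
            filter_upwards [ae_restrict_mem measurableSet_Ioi] with t ht
            have ht : 0 < t := ht
            exact mul_nonneg (one_sub_exp_neg_nonneg (by positivity)) (Real.rpow_nonneg ht.le _)
        _ = l ^ s := by rw [he, ← hc]; field_simp
    · simp_rw [hint]
      rcases hl.eq_or_lt with rfl | hl
      · simp [Real.zero_rpow hs.ne']
      obtain ⟨hi, he⟩ := integral_one_sub_exp_scale hs hs1 hl
      have hU : ⋃ n : ℕ, Set.Ioi (1 / ((n : ℝ) + 1)) = Set.Ioi 0 := by
        refine Set.Subset.antisymm (Set.iUnion_subset hsub) fun t ht => ?_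
        obtain ⟨n, hn⟩ := exists_nat_one_div_lt (show (0 : ℝ) < t from ht)
        exact Set.mem_iUnion.2 ⟨n, hn⟩
      have hmono : Monotone fun n : ℕ => Set.Ioi (1 / ((n : ℝ) + 1)) := by
        intro m n hmn
        exact Set.Ioi_subset_Ioi (Nat.one_div_le_one_div hmn)
      have := (tendsto_setIntegral_of_monotone (fun n => measurableSet_Ioi) hmono
        (by rw [hU]; exact hi)).const_mul c⁻¹
      rw [hU, he, ← hc] at this
      convert this using 2
      field_simp

open Complex in
/-- The symbol `‖ξ‖ ^ α`, for `0 < α ≤ 2`, is a limit from below of symbols of compound Poisson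
generators. -/
theorem exists_jump_measure {E : Type*} [NormedAddCommGroup E] [InnerProductSpace ℝ E]
    [FiniteDimensional ℝ E] [MeasurableSpace E] [BorelSpace E] {α : ℝ} (hα : 0 < α) (hα' : α ≤ 2) :
    ∃ (κ : ℕ → Measure E) (m : ℕ → E → ℝ), (∀ n, IsFiniteMeasure (κ n)) ∧
      (∀ n ξ, ∫ y, (1 - cexp (inner ℝ y ξ * I)) ∂κ n = m n ξ) ∧
      (∀ n ξ, |m n ξ| ≤ ‖ξ‖ ^ α) ∧
      ∀ ξ, Tendsto (fun n => m n ξ) atTop (𝓝 (‖ξ‖ ^ α)) := by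
  obtain ⟨ν, hν, hν0, hle, hlim⟩ := exists_levy_measure (s := α / 2) (by linarith) (by linarith)
  have hpow : ∀ ξ : E, (‖ξ‖ ^ 2) ^ (α / 2) = ‖ξ‖ ^ α := fun ξ => by
    rw [← Real.rpow_natCast, ← Real.rpow_mul (norm_nonneg _)]
    congr 1; push_cast; ring
  have hF : Measurable fun z : ℝ × E => Real.sqrt (2 * z.1) • z.2 := by fun_prop
  -- The image measure of √(2t) Z, with t under ν_n and Z standard Gaussian: for fixed t its
  -- characteristic function is exp(-t‖ξ‖²), so the symbol is the ν_n-integral of 1 - exp(-t‖ξ‖²).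
  refine ⟨fun n => ((ν n).prod (ProbabilityTheory.stdGaussian E)).map
      (fun z => Real.sqrt (2 * z.1) • z.2),
    fun n ξ => ∫ t, (1 - Real.exp (-(t * ‖ξ‖ ^ 2))) ∂ν n, fun n => ?_, fun n ξ => ?_,
    fun n ξ => ?_, fun ξ => ?_⟩
  · have := hν n
    infer_instance
  · have := hν n
    have hb : ∀ y : E, ‖1 - cexp (inner ℝ y ξ * I)‖ ≤ 2 := fun y => by
      refine (norm_sub_le _ _).trans ?_
      rw [norm_exp_ofReal_mul_I]; norm_num
    have hc : Continuous fun y : E => 1 - cexp (inner ℝ y ξ * I) := by fun_prop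
    rw [integral_map hF.aemeasurable hc.aestronglyMeasurable, integral_prod]
    · rw [← integral_complex_ofReal]
      refine integral_congr_ae ?_
      filter_upwards [hν0 n] with t ht
      have hi : Integrable (fun y : E => cexp (inner ℝ (Real.sqrt (2 * t) • y) ξ * I))
          (ProbabilityTheory.stdGaussian E) := by
        refine Integrable.of_bound (C := 1) ?_ (ae_of_all _ fun y => ?_)
        · exact Continuous.aestronglyMeasurable (by fun_prop)
        · rw [norm_exp_ofReal_mul_I]
      have h2 : ∫ y, cexp (inner ℝ (Real.sqrt (2 * t) • y) ξ * I)
          ∂(ProbabilityTheory.stdGaussian E) = cexp (-(t * ‖ξ‖ ^ 2)) := by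
        have := ProbabilityTheory.charFun_stdGaussian (E := E) (Real.sqrt (2 * t) • ξ)
        rw [charFun_apply] at this
        simp_rw [inner_smul_left, inner_smul_right] at this ⊢
        simp only [conj_trivial]
        rw [this, norm_smul, Real.norm_eq_abs, abs_of_nonneg (Real.sqrt_nonneg _)]
        congr 1
        rw [← ofReal_pow, mul_pow, Real.sq_sqrt (by positivity)]
        push_cast; ring
      rw [integral_sub (integrable_const _) hi, h2]
      simp
    · exact Integrable.of_bound (C := 2)
        ((hc.measurable.comp hF).aestronglyMeasurable) (ae_of_all _ fun z => hb _)
  · rw [abs_of_nonneg, ← hpow]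
    · exact hle n _ (by positivity)
    · refine integral_nonneg_of_ae ?_
      filter_upwards [hν0 n] with t ht
      exact one_sub_exp_neg_nonneg (by positivity)
  · rw [← hpow]
    exact hlim _ (by positivity)

end Subordination

/-! ### Fourier decay of the spatial slices, uniform in time -/

section Slices

variable {d : ℕ}

local notation "𝔼" => EuclideanSpace ℝ (Fin d)

theorem norm_iteratedFDeriv_slice_le {F : Type*} [NormedAddCommGroup F] [NormedSpace ℝ F]
    {Φ : ℝ × 𝔼 → F} (hΦ : ContDiff ℝ ∞ Φ) (j : ℕ) (s : ℝ) (y : 𝔼) :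
    ‖iteratedFDeriv ℝ j (fun y => Φ (s, y)) y‖ ≤ ‖iteratedFDeriv ℝ j Φ (s, y)‖ := by
  have h1 : (fun y => Φ (s, y)) =
      (fun z => Φ ((s, 0) + z)) ∘ (ContinuousLinearMap.inr ℝ ℝ 𝔼) := by
    ext y; simp
  have h2 : ContDiff ℝ ∞ (fun z : ℝ × 𝔼 => Φ ((s, 0) + z)) := hΦ.comp (by fun_prop)
  rw [h1, ContinuousLinearMap.iteratedFDeriv_comp_right _ h2 _ (i := j) (by exact_mod_cast le_top),
    iteratedFDeriv_comp_add_left]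
  refine (ContinuousMultilinearMap.norm_compContinuousLinearMap_le _ _).trans ?_
  simp only [ContinuousLinearMap.inr_apply, Prod.mk_add_mk, add_zero, zero_add]
  refine mul_le_of_le_one_right (norm_nonneg _) (Finset.prod_le_one (fun _ _ => norm_nonneg _) ?_)
  intro _ _
  exact ContinuousLinearMap.norm_inr_le_one _ _ _

theorem hasCompactSupport_slice {F : Type*} [Zero F] {Φ : ℝ × 𝔼 → F}
    (hc : HasCompactSupport Φ) (s : ℝ) : HasCompactSupport fun y => Φ (s, y) := by
  refine HasCompactSupport.intro (hc.isCompact.image continuous_snd) fun y hy => ?_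
  by_contra h
  exact hy ⟨(s, y), subset_tsupport _ h, rfl⟩

theorem contDiff_slice {F : Type*} [NormedAddCommGroup F] [NormedSpace ℝ F] {Φ : ℝ × 𝔼 → F}
    (hΦ : ContDiff ℝ ∞ Φ) (s : ℝ) : ContDiff ℝ ∞ fun y => Φ (s, y) :=
  hΦ.comp (by fun_prop)

/-- The point is that C does not depend on s: derivatives of slices are bounded by derivatives of Φ,
and all slices are supported in the projection of the support of Φ. -/
theorem exists_pow_mul_fourier_slice_le {Φ : ℝ × 𝔼 → ℂ} (hΦ : ContDiff ℝ ∞ Φ)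
    (hc : HasCompactSupport Φ) (n : ℕ) :
    ∃ C, ∀ s ξ, ‖ξ‖ ^ n * ‖𝓕 (fun y => Φ (s, y)) ξ‖ ≤ C := by
  have hb : ∀ j : ℕ, ∃ D, ∀ z, ‖iteratedFDeriv ℝ j Φ z‖ ≤ D := fun j =>
    (hΦ.continuous_iteratedFDeriv (m := j) (by exact_mod_cast le_top)).bounded_above_of_compact_support
      (hc.iteratedFDeriv j)
  choose D hD using hb
  set K := Prod.snd '' tsupport Φ with hKdef
  have hK : IsCompact K := hc.isCompact.image continuous_snd
  refine ⟨2 ^ n * ∑ p ∈ Finset.range 1 ×ˢ Finset.range (n + 1), D p.2 * volume.real K,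
    fun s ξ => ?_⟩
  have hs := contDiff_slice hΦ s
  have hsc := hasCompactSupport_slice hc s
  have hcont : ∀ j : ℕ, Continuous (iteratedFDeriv ℝ j fun y => Φ (s, y)) := fun j =>
    hs.continuous_iteratedFDeriv (by exact_mod_cast le_top)
  have h := Real.pow_mul_norm_iteratedFDeriv_fourier_le (K := 0) (N := ⊤) hs
    (fun k j _ _ => ((continuous_norm.pow k).mul (hcont j).norm).integrable_of_hasCompactSupport
      ((hsc.iteratedFDeriv j).norm.mul_left)) (k := 0) (n := n) le_rfl le_top ξ
  simp only [norm_iteratedFDeriv_zero, pow_zero, one_mul, Nat.cast_zero, mul_zero, zero_add] at h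
  refine h.trans ?_
  gcongr with p hp
  have hp1 : p.1 = 0 := by
    have := (Finset.mem_product.1 hp).1
    simpa using this
  simp only [hp1, pow_zero, one_mul]
  have hsupp : ∀ y, y ∉ K → ‖iteratedFDeriv ℝ p.2 (fun y => Φ (s, y)) y‖ = 0 := by
    intro y hy
    have h1 := norm_iteratedFDeriv_slice_le hΦ p.2 s y
    have h2 : iteratedFDeriv ℝ p.2 Φ (s, y) = 0 := by
      by_contra h
      exact hy ⟨(s, y), support_iteratedFDeriv_subset _ h, rfl⟩
    rw [h2, norm_zero] at h1
    exact le_antisymm h1 (norm_nonneg _)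
  rw [← setIntegral_eq_integral_of_forall_compl_eq_zero hsupp]
  have := norm_setIntegral_le_of_norm_le_const (μ := volume) (s := K) (C := D p.2)
    (f := fun y => ‖iteratedFDeriv ℝ p.2 (fun y => Φ (s, y)) y‖) hK.measure_lt_top
    (fun y _ => by
      rw [norm_norm]
      exact (norm_iteratedFDeriv_slice_le hΦ p.2 s y).trans (hD _ _))
  exact (Real.le_norm_self _).trans this

/-- The exponent d + 3 leaves 2 powers for the symbol, as α ≤ 2, and d + 1 for integrability. -/
theorem exists_fourier_slice_le {Φ : ℝ × 𝔼 → ℂ} (hΦ : ContDiff ℝ ∞ Φ)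
    (hc : HasCompactSupport Φ) :
    ∃ C, 0 ≤ C ∧ ∀ s ξ, ‖𝓕 (fun y => Φ (s, y)) ξ‖ ≤ C * (1 + ‖ξ‖) ^ (-((d : ℝ) + 3)) := by
  obtain ⟨C0, h0⟩ := exists_pow_mul_fourier_slice_le hΦ hc 0
  obtain ⟨C1, h1⟩ := exists_pow_mul_fourier_slice_le hΦ hc (d + 3)
  refine ⟨2 ^ (d + 3 - 1) * (|C0| + |C1|), by positivity, fun s ξ => ?_⟩
  have hpos : (0 : ℝ) < 1 + ‖ξ‖ := by positivity
  rw [Real.rpow_neg hpos.le, ← div_eq_mul_inv, le_div_iff₀ (Real.rpow_pos_of_pos hpos _)]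
  have h2 : (1 + ‖ξ‖) ^ ((d : ℝ) + 3) = (1 + ‖ξ‖) ^ (d + 3) := by
    rw [← Real.rpow_natCast]; push_cast; rfl
  rw [h2]
  have h3 := add_pow_le (zero_le_one) (norm_nonneg ξ) (d + 3)
  rw [one_pow] at h3
  have h0' := (h0 s ξ).trans (le_abs_self C0)
  have h1' := (h1 s ξ).trans (le_abs_self C1)
  rw [pow_zero, one_mul] at h0'
  calc ‖𝓕 (fun y => Φ (s, y)) ξ‖ * (1 + ‖ξ‖) ^ (d + 3)
      ≤ ‖𝓕 (fun y => Φ (s, y)) ξ‖ * (2 ^ (d + 3 - 1) * (1 + ‖ξ‖ ^ (d + 3))) := by gcongr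
    _ = 2 ^ (d + 3 - 1) * (‖𝓕 (fun y => Φ (s, y)) ξ‖ +
          ‖ξ‖ ^ (d + 3) * ‖𝓕 (fun y => Φ (s, y)) ξ‖) := by ring
    _ ≤ _ := by gcongr

/-- An integrable majorant of the Fourier transforms of the slices, multiplied by the symbol. -/
theorem exists_fourier_majorant {α : ℝ} (hα : 0 < α) (hα' : α ≤ 2) {Φ : ℝ × 𝔼 → ℂ}
    (hΦ : ContDiff ℝ ∞ Φ) (hc : HasCompactSupport Φ) :
    ∃ W : 𝔼 → ℝ, Integrable W ∧ (∀ s ξ, ‖𝓕 (fun y => Φ (s, y)) ξ‖ ≤ W ξ) ∧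
      ∀ s ξ, (2 * Real.pi * ‖ξ‖) ^ α * ‖𝓕 (fun y => Φ (s, y)) ξ‖ ≤ W ξ := by
  obtain ⟨C, hC, h⟩ := exists_fourier_slice_le hΦ hc
  have hpi : 1 ≤ (2 * Real.pi) ^ α :=
    Real.one_le_rpow (by linarith [Real.pi_gt_three]) hα.le
  refine ⟨fun ξ => (2 * Real.pi) ^ α * C * (1 + ‖ξ‖) ^ (-((d : ℝ) + 1)), ?_, fun s ξ => ?_,
    fun s ξ => ?_⟩
  · refine (integrable_one_add_norm ?_).const_mul _
    simp
  · refine (h s ξ).trans ?_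
    have h1 : (1 : ℝ) ≤ 1 + ‖ξ‖ := by simp
    have h2 : (1 + ‖ξ‖) ^ (-((d : ℝ) + 3)) ≤ (1 + ‖ξ‖) ^ (-((d : ℝ) + 1)) :=
      Real.rpow_le_rpow_of_exponent_le h1 (by linarith)
    calc C * (1 + ‖ξ‖) ^ (-((d : ℝ) + 3)) ≤ 1 * C * (1 + ‖ξ‖) ^ (-((d : ℝ) + 1)) := by
          rw [one_mul]; gcongr
      _ ≤ (2 * Real.pi) ^ α * C * (1 + ‖ξ‖) ^ (-((d : ℝ) + 1)) := by gcongr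
  · have h1 : (1 : ℝ) ≤ 1 + ‖ξ‖ := by simp
    have hpos : (0 : ℝ) < 1 + ‖ξ‖ := by positivity
    rw [Real.mul_rpow (by positivity) (norm_nonneg _)]
    calc (2 * Real.pi) ^ α * ‖ξ‖ ^ α * ‖𝓕 (fun y => Φ (s, y)) ξ‖
        ≤ (2 * Real.pi) ^ α * (1 + ‖ξ‖) ^ (2 : ℝ) * (C * (1 + ‖ξ‖) ^ (-((d : ℝ) + 3))) := by
          gcongr
          · calc ‖ξ‖ ^ α ≤ (1 + ‖ξ‖) ^ α :=
                  Real.rpow_le_rpow (norm_nonneg _) (by linarith) hα.le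
              _ ≤ (1 + ‖ξ‖) ^ (2 : ℝ) := Real.rpow_le_rpow_of_exponent_le h1 hα'
          · exact h s ξ
      _ = (2 * Real.pi) ^ α * C * ((1 + ‖ξ‖) ^ (2 : ℝ) * (1 + ‖ξ‖) ^ (-((d : ℝ) + 3))) := by ring
      _ = _ := by
          rw [← Real.rpow_add hpos]
          congr 2; ring

end Slices

/-! ### Jump-operator approximation and scaling of the fractional Laplacian -/

section Generator

variable {d : ℕ}

local notation "𝔼" => EuclideanSpace ℝ (Fin d)

open Complex in
-- Fourier inversion at x and at x + y, then Fubini, which is allowed since κ is finite and the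
-- symbol factor is bounded by 2. The argument 2πξ of m reflects the normalisation of the Fourier
-- transform.
theorem ofReal_integral_sub_translate {f : 𝔼 → ℝ} (hf : Continuous f)
    (hfi : Integrable f) (hF : Integrable (𝓕 fun y => (f y : ℂ))) {κ : Measure 𝔼}
    [IsFiniteMeasure κ] {m : 𝔼 → ℝ}
    (hm : ∀ ξ, ∫ y, (1 - cexp (inner ℝ y ξ * I)) ∂κ = m ξ) (x : 𝔼) :
    ((∫ y, (f x - f (x + y)) ∂κ : ℝ) : ℂ) =
      𝓕⁻ (fun ξ => (m ((2 * Real.pi) • ξ) : ℂ) * 𝓕 (fun y => (f y : ℂ)) ξ) x := by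
  set F := 𝓕 (fun y => (f y : ℂ)) with hFdef
  have hinv : ∀ x, (f x : ℂ) = ∫ ξ, cexp (↑(2 * Real.pi * inner ℝ ξ x) * I) * F ξ := by
    intro x
    have h := (continuous_ofReal.comp hf).fourierInv_fourier_eq hfi.ofReal hF
    have h2 := congrFun h x
    rw [Real.fourierInv_eq'] at h2
    exact h2.symm
  have hE : ∀ x, Integrable fun ξ => cexp (↑(2 * Real.pi * inner ℝ ξ x) * I) * F ξ := fun x =>
    hF.bdd_mul (c := 1) (Continuous.aestronglyMeasurable (by fun_prop))
      (ae_of_all _ fun ξ => by rw [norm_exp_ofReal_mul_I])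
  have hdiff : ∀ y, ((f x - f (x + y) : ℝ) : ℂ) = ∫ ξ, cexp (↑(2 * Real.pi * inner ℝ ξ x) * I) *
      (1 - cexp (inner ℝ y ((2 * Real.pi) • ξ) * I)) * F ξ := by
    intro y
    rw [ofReal_sub, hinv x, hinv (x + y), ← integral_sub (hE x) (hE (x + y))]
    congr 1; ext ξ
    have : cexp (↑(2 * Real.pi * inner ℝ ξ (x + y)) * I) =
        cexp (↑(2 * Real.pi * inner ℝ ξ x) * I) * cexp (inner ℝ y ((2 * Real.pi) • ξ) * I) := by
      rw [← Complex.exp_add, inner_add_right, inner_smul_right, real_inner_comm ξ y]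
      congr 1; push_cast; ring
    rw [this]; ring
  have hint : Integrable (fun z : 𝔼 × 𝔼 => cexp (↑(2 * Real.pi * inner ℝ z.2 x) * I) *
      (1 - cexp (inner ℝ z.1 ((2 * Real.pi) • z.2) * I)) * F z.2) (κ.prod volume) := by
    refine (hF.comp_snd κ).bdd_mul (c := 2) (Continuous.aestronglyMeasurable (by fun_prop))
      (ae_of_all _ fun z => ?_)
    rw [norm_mul, norm_exp_ofReal_mul_I, one_mul]
    refine (norm_sub_le _ _).trans ?_
    rw [norm_exp_ofReal_mul_I]; norm_num
  rw [← integral_complex_ofReal]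
  simp_rw [hdiff]
  rw [integral_integral_swap hint, Real.fourierInv_eq']
  congr 1; ext ξ
  simp_rw [mul_assoc]
  rw [integral_const_mul, integral_mul_const, hm]
  rfl

/-- A sequence of compound Poisson generators approximating the fractional Laplacian. -/
theorem exists_generator_approx {α : ℝ} (hα : 0 < α) (hα' : α ≤ 2) :
    ∃ κ : ℕ → Measure 𝔼, (∀ n, IsFiniteMeasure (κ n)) ∧
      ∀ φ : ℝ × 𝔼 → ℝ, ContDiff ℝ ∞ φ → HasCompactSupport φ →
        ∃ C, (∀ n s x, |∫ y, (φ (s, x) - φ (s, x + y)) ∂κ n| ≤ C) ∧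
          ∀ s x, Tendsto (fun n => ∫ y, (φ (s, x) - φ (s, x + y)) ∂κ n) atTop
            (𝓝 (fracLaplacian α (fun y => φ (s, y)) x)) := by
  obtain ⟨κ, m, hκ, hm, hle, hlim⟩ := exists_jump_measure (E := 𝔼) hα hα'
  refine ⟨κ, hκ, fun φ hφ hc => ?_⟩
  have hΦ : ContDiff ℝ ∞ fun z => (φ z : ℂ) := Complex.ofRealCLM.contDiff.comp hφ
  have hΦc : HasCompactSupport fun z => (φ z : ℂ) := hc.comp_left (g := fun r : ℝ => (r : ℂ)) (by simp)
  obtain ⟨W, hW, hW0, hWα⟩ := exists_fourier_majorant hα hα' hΦ hΦc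
  have hnorm : ∀ ξ : 𝔼, ‖(2 * Real.pi) • ξ‖ = 2 * Real.pi * ‖ξ‖ := fun ξ => by
    rw [norm_smul, Real.norm_of_nonneg (by positivity)]
  have hfi : ∀ s, Integrable fun y => φ (s, y) := fun s =>
    (contDiff_slice hφ s).continuous.integrable_of_hasCompactSupport (hasCompactSupport_slice hc s)
  have hFc : ∀ s, Continuous (𝓕 fun y => (φ (s, y) : ℂ)) := fun s =>
    VectorFourier.fourierIntegral_continuous Real.continuous_fourierChar
      (by exact continuous_inner) (hfi s).ofReal
  have hF : ∀ s, Integrable (𝓕 fun y => (φ (s, y) : ℂ)) := fun s =>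
    hW.mono' (hFc s).aestronglyMeasurable (ae_of_all _ (hW0 s))
  have heq : ∀ n s x, ((∫ y, (φ (s, x) - φ (s, x + y)) ∂κ n : ℝ) : ℂ) =
      𝓕⁻ (fun ξ => (m n ((2 * Real.pi) • ξ) : ℂ) * 𝓕 (fun y => (φ (s, y) : ℂ)) ξ) x := by
    intro n s x
    have := hκ n
    exact ofReal_integral_sub_translate (f := fun y => φ (s, y)) (contDiff_slice hφ s).continuous
      (hfi s) (hF s) (hm n) x
  have hbound : ∀ n s ξ, ‖(m n ((2 * Real.pi) • ξ) : ℂ) * 𝓕 (fun y => (φ (s, y) : ℂ)) ξ‖ ≤ W ξ := by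
    intro n s ξ
    refine le_trans ?_ (hWα s ξ)
    rw [norm_mul, Complex.norm_real, Real.norm_eq_abs, ← hnorm]
    gcongr
    exact hle n _
  refine ⟨∫ ξ, W ξ, fun n s x => ?_, fun s x => ?_⟩
  · rw [← Real.norm_eq_abs, ← Complex.norm_real, heq, Real.fourierInv_eq']
    refine norm_integral_le_of_norm_le hW (ae_of_all _ fun ξ => ?_)
    rw [norm_smul, Complex.norm_exp_ofReal_mul_I, one_mul]
    exact hbound n s ξ
  · have hmeas : ∀ n, AEStronglyMeasurable (fun ξ : 𝔼 => (m n ((2 * Real.pi) • ξ) : ℂ)) := by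
      intro n
      have := hκ n
      have : (fun ξ : 𝔼 => (m n ((2 * Real.pi) • ξ) : ℂ)) = fun ξ : 𝔼 =>
          ∫ y, (1 - Complex.exp (inner ℝ y ((2 * Real.pi) • ξ) * Complex.I)) ∂κ n := by
        ext ξ; rw [hm]
      rw [this]
      have hc : Continuous (Function.uncurry fun (ξ y : 𝔼) =>
        (1 - Complex.exp (inner ℝ y ((2 * Real.pi) • ξ) * Complex.I))) := by fun_prop
      exact (hc.stronglyMeasurable.integral_prod_right).aestronglyMeasurable
    have key : Tendsto (fun n => 𝓕⁻ (fun ξ => (m n ((2 * Real.pi) • ξ) : ℂ) *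
        𝓕 (fun y => (φ (s, y) : ℂ)) ξ) x) atTop
        (𝓝 (𝓕⁻ (fun ξ : 𝔼 => (((2 * Real.pi * ‖ξ‖) ^ α : ℝ) : ℂ) *
          𝓕 (fun y : 𝔼 => (φ (s, y) : ℂ)) ξ) x)) := by
      simp_rw [Real.fourierInv_eq']
      refine tendsto_integral_of_dominated_convergence W (fun n => ?_) hW
        (fun n => ae_of_all _ fun ξ => ?_) (ae_of_all _ fun ξ => ?_)
      · have hce : Continuous fun ξ : 𝔼 =>
            Complex.exp (↑(2 * Real.pi * inner ℝ ξ x) * Complex.I) := by fun_prop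
        exact hce.aestronglyMeasurable.smul ((hmeas n).mul (hFc s).aestronglyMeasurable)
      · rw [norm_smul, Complex.norm_exp_ofReal_mul_I, one_mul]
        exact hbound n s ξ
      · refine Tendsto.const_smul (Tendsto.mul_const _ ?_) _
        rw [← hnorm]
        exact (Complex.continuous_ofReal.tendsto _).comp (hlim _)
    have := (Complex.continuous_re.tendsto _).comp key
    refine this.congr fun n => ?_
    simp only [Function.comp]
    rw [← heq, Complex.ofReal_re]

/-- The sup norm is bounded by the L¹ norm of symbol times transform; the symbol is homogeneous of
degree α and dilation preserves the L¹ norm of the transform. The change of variables and the norm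
inequality hold for Bochner integrals without integrability, so nothing is asked of χ. -/
theorem abs_fracLaplacian_comp_smul_le (α : ℝ) (χ : 𝔼 → ℝ) :
    ∃ C, ∀ R : ℝ, 0 < R → ∀ x, |fracLaplacian α (fun y => χ (R⁻¹ • y)) x| ≤ C * R ^ (-α) := by
  refine ⟨∫ ξ : 𝔼, ‖(((2 * Real.pi * ‖ξ‖) ^ α : ℝ) : ℂ) * 𝓕 (fun y : 𝔼 => (χ y : ℂ)) ξ‖,
    fun R hR x => ?_⟩
  have hscale : ∀ ξ : 𝔼, 𝓕 (fun y : 𝔼 => (χ (R⁻¹ • y) : ℂ)) ξ =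
      ((R ^ Module.finrank ℝ 𝔼 : ℝ) : ℂ) * 𝓕 (fun y : 𝔼 => (χ y : ℂ)) (R • ξ) := by
    intro ξ
    rw [Real.fourier_eq', Real.fourier_eq']
    have := Measure.integral_comp_inv_smul_of_nonneg (volume : Measure 𝔼)
      (fun v => Complex.exp (↑(-2 * Real.pi * inner ℝ v (R • ξ)) * Complex.I) • (χ v : ℂ)) hR.le
    rw [Complex.real_smul] at this
    rw [← this]
    congr 1; ext v
    rw [inner_smul_left, inner_smul_right]
    congr 5
    simp [hR.ne']
  refine (Complex.abs_re_le_norm _).trans ?_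
  rw [Real.fourierInv_eq']
  refine (norm_integral_le_integral_norm _).trans (le_of_eq ?_)
  have h2 : ∀ ξ : 𝔼, ‖Complex.exp (↑(2 * Real.pi * inner ℝ ξ x) * Complex.I) •
      ((((2 * Real.pi * ‖ξ‖) ^ α : ℝ) : ℂ) * 𝓕 (fun y : 𝔼 => (χ (R⁻¹ • y) : ℂ)) ξ)‖ =
      R ^ Module.finrank ℝ 𝔼 * R ^ (-α) *
        ‖(((2 * Real.pi * ‖R • ξ‖) ^ α : ℝ) : ℂ) * 𝓕 (fun y : 𝔼 => (χ y : ℂ)) (R • ξ)‖ := by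
    intro ξ
    have h3 : (2 * Real.pi * ‖ξ‖) ^ α = R ^ (-α) * (2 * Real.pi * ‖R • ξ‖) ^ α := by
      rw [norm_smul, Real.norm_of_nonneg hR.le, show 2 * Real.pi * (R * ‖ξ‖) =
        R * (2 * Real.pi * ‖ξ‖) by ring, Real.mul_rpow hR.le (by positivity), ← mul_assoc,
        ← Real.rpow_add hR]
      simp
    rw [norm_smul, Complex.norm_exp_ofReal_mul_I, one_mul, hscale, h3]
    simp only [norm_mul, Complex.norm_real, Real.norm_eq_abs]
    rw [abs_of_nonneg (pow_nonneg hR.le _), abs_of_nonneg (Real.rpow_nonneg hR.le (-α))]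
    ring
  simp_rw [h2]
  rw [integral_const_mul, Measure.integral_comp_smul_of_nonneg (volume : Measure 𝔼)
    (fun ξ => ‖(((2 * Real.pi * ‖ξ‖) ^ α : ℝ) : ℂ) * 𝓕 (fun y : 𝔼 => (χ y : ℂ)) ξ‖) R (hR := hR.le),
    smul_eq_mul]
  field_simp

/-- The y-integral stands outside, so that an inequality proved for each jump y integrates against
κ_n and passes to the limit. Uniform bounds on the jump operators dominate the limit, and also give
boundedness and joint measurability of Λφ. -/
theorem exists_jump_form_approx {α : ℝ} (hα : 0 < α) (hα' : α ≤ 2) :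
    ∃ κ : ℕ → Measure 𝔼, (∀ n, IsFiniteMeasure (κ n)) ∧
      ∀ φ : ℝ × 𝔼 → ℝ, ContDiff ℝ ∞ φ → HasCompactSupport φ →
        (Measurable fun z : ℝ × 𝔼 => fracLaplacian α (fun y => φ (z.1, y)) z.2) ∧
        (∃ C, ∀ z : ℝ × 𝔼, |fracLaplacian α (fun y => φ (z.1, y)) z.2| ≤ C) ∧
        ∀ u : ℝ × 𝔼 → ℝ, Integrable u →
          Tendsto (fun n => ∫ y, (∫ z, u z * (φ z - φ (z + (0, y)))) ∂κ n) atTop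
            (𝓝 (∫ z, u z * fracLaplacian α (fun y => φ (z.1, y)) z.2)) := by
  obtain ⟨κ, hκ, h⟩ := exists_generator_approx (d := d) hα hα'
  refine ⟨κ, hκ, fun φ hφ hc => ?_⟩
  obtain ⟨C, hC, hlim⟩ := h φ hφ hc
  have hφc := hφ.continuous
  have hmeas : ∀ n, StronglyMeasurable
      fun z : ℝ × 𝔼 => ∫ y, (φ (z.1, z.2) - φ (z.1, z.2 + y)) ∂κ n := fun n => by
    have := hκ n
    have hc : Continuous (Function.uncurry fun (z : ℝ × 𝔼) (y : 𝔼) =>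
      φ (z.1, z.2) - φ (z.1, z.2 + y)) := by fun_prop
    exact hc.stronglyMeasurable.integral_prod_right
  have hbound : ∀ z : ℝ × 𝔼, |fracLaplacian α (fun y => φ (z.1, y)) z.2| ≤ C := fun z =>
    le_of_tendsto (hlim z.1 z.2).abs (Eventually.of_forall fun n => hC n _ _)
  refine ⟨measurable_of_tendsto_metrizable (fun n => (hmeas n).measurable)
    (tendsto_pi_nhds.2 fun z => hlim z.1 z.2), ⟨C, hbound⟩, fun u hu => ?_⟩
  obtain ⟨D, hD⟩ := hφc.bounded_above_of_compact_support hc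
  have hswap : ∀ n, ∫ y, (∫ z, u z * (φ z - φ (z + (0, y)))) ∂κ n =
      ∫ z, u z * ∫ y, (φ (z.1, z.2) - φ (z.1, z.2 + y)) ∂κ n := by
    intro n
    have := hκ n
    have hi : Integrable (fun w : 𝔼 × (ℝ × 𝔼) => u w.2 * (φ w.2 - φ (w.2 + (0, w.1))))
        ((κ n).prod volume) := by
      refine (hu.comp_snd (κ n)).mul_bdd (c := D + D)
        (Continuous.aestronglyMeasurable (by fun_prop)) (ae_of_all _ fun w => ?_)
      exact (norm_sub_le _ _).trans (add_le_add (hD _) (hD _))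
    rw [integral_integral_swap hi]
    congr 1; ext z
    rw [integral_const_mul]
    refine congrArg (u z * ·) (integral_congr_ae (ae_of_all _ fun y => ?_))
    change φ z - φ (z.1 + 0, z.2 + y) = φ z - φ (z.1, z.2 + y)
    rw [add_zero]
  simp_rw [hswap]
  refine tendsto_integral_of_dominated_convergence (fun z => |u z| * C)
    (fun n => hu.1.mul (hmeas n).aestronglyMeasurable) (hu.abs.mul_const C)
    (fun n => ae_of_all _ fun z => ?_) (ae_of_all _ fun z => (hlim z.1 z.2).const_mul _)
  rw [Real.norm_eq_abs, abs_mul]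
  exact mul_le_mul_of_nonneg_left (hC n _ _) (abs_nonneg _)

end Generator

/-! ### Weak derivatives, mollification and the chain rule -/

section WeakCalculus

variable {d : ℕ} {T : ℝ}

local notation "𝔼" => EuclideanSpace ℝ (Fin d)

instance isAddHaarMeasure_spaceTime : (volume : Measure (ℝ × 𝔼)).IsAddHaarMeasure :=
  Measure.prod.instIsAddHaarMeasure _ _

theorem isOpen_slab : IsOpen (slab d T) := isOpen_Ioo.prod isOpen_univ

theorem hasFDerivAt_space {φ : ℝ × 𝔼 → ℝ} {z : ℝ × 𝔼} (h : DifferentiableAt ℝ φ z) (w : 𝔼) :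
    spaceDeriv φ z w = fderiv ℝ φ z (0, w) := by
  have h1 : HasFDerivAt (fun y : 𝔼 => (z.1, y)) (ContinuousLinearMap.inr ℝ ℝ 𝔼) z.2 :=
    hasFDerivAt_prodMk_right z.1 z.2
  have h2 : HasFDerivAt (fun y => φ (z.1, y)) _ z.2 :=
    HasFDerivAt.comp (g := φ) z.2 (by exact h.hasFDerivAt) h1
  rw [spaceDeriv, h2.fderiv]
  simp

theorem hasFDerivAt_time {φ : ℝ × 𝔼 → ℝ} {z : ℝ × 𝔼} (h : DifferentiableAt ℝ φ z) :
    timeDeriv φ z = fderiv ℝ φ z (1, 0) := by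
  have h1 : HasFDerivAt (fun s : ℝ => (s, z.2)) (ContinuousLinearMap.inl ℝ ℝ 𝔼) z.1 :=
    hasFDerivAt_prodMk_left z.1 z.2
  have h2 : HasFDerivAt (fun s => φ (s, z.2)) _ z.1 :=
    HasFDerivAt.comp (g := φ) z.1 (by exact h.hasFDerivAt) h1
  rw [timeDeriv, h2.hasDerivAt.deriv]
  simp

theorem fderiv_space_eq_sum (φ : ℝ × 𝔼 → ℝ) (z : ℝ × 𝔼) (w : 𝔼) :
    fderiv ℝ φ z (0, w) =
      ∑ i, w i * fderiv ℝ φ z (0, EuclideanSpace.single i (1 : ℝ)) := by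
  have hw : ((0 : ℝ), w) = ∑ i, w i • ((0 : ℝ), EuclideanSpace.single i (1 : ℝ)) := by
    have h1 := (EuclideanSpace.basisFun (Fin d) ℝ).sum_repr w
    simp only [EuclideanSpace.basisFun_repr, EuclideanSpace.basisFun_apply] at h1
    refine Prod.ext ?_ ?_
    · simp [Prod.fst_sum]
    · simp only [Prod.snd_sum, Prod.smul_snd]
      exact h1.symm
  conv_lhs => rw [hw]
  rw [map_sum]
  exact Finset.sum_congr rfl fun i _ => by rw [map_smul, smul_eq_mul]

theorem MemLpLoc.apply {p : ℝ≥0∞} {v : ℝ → 𝔼 → 𝔼} (hv : MemLpLoc T p v) (i : Fin d) :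
    MemLpLoc T p (fun s x => v s x i) := by
  intro K hK hKs
  have h := hv K hK hKs
  refine MemLp.of_le h ?_ (ae_of_all _ fun z => PiLp.norm_apply_le _ i)
  exact (EuclideanSpace.proj (𝕜 := ℝ) i).continuous.comp_aestronglyMeasurable h.1

theorem memLp_indicator {p : ℝ≥0∞} {f : ℝ → 𝔼 → ℝ} (hf : MemLpLoc T p f) {K : Set (ℝ × 𝔼)}
    (hK : IsCompact K) (hKs : K ⊆ slab d T) :
    MemLp (K.indicator fun z => f z.1 z.2) p :=
  (memLp_indicator_iff_restrict hK.measurableSet).2 (hf K hK hKs)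

theorem memLp_mul_of_support {p : ℝ≥0∞} {f : ℝ → 𝔼 → ℝ} (hf : MemLpLoc T p f) {h : ℝ × 𝔼 → ℝ}
    (hh : Continuous h) (hc : HasCompactSupport h) (hs : tsupport h ⊆ slab d T) :
    MemLp (fun z => h z * f z.1 z.2) p := by
  obtain ⟨C, hC⟩ := hh.bounded_above_of_compact_support hc
  have h1 := memLp_indicator hf hc.isCompact hs
  have h2 : (fun z => h z * f z.1 z.2) =
      fun z => h z * (tsupport h).indicator (fun z => f z.1 z.2) z := by
    ext z
    by_cases hz : z ∈ tsupport h
    · rw [Set.indicator_of_mem hz]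
    · rw [image_eq_zero_of_notMem_tsupport hz]; simp
  rw [h2]
  refine MemLp.of_le_mul (c := C) h1 (hh.aestronglyMeasurable.mul h1.1) (ae_of_all _ fun z => ?_)
  rw [norm_mul]
  gcongr
  exact hC z

theorem IsTest.fderiv_apply {φ : ℝ × 𝔼 → ℝ} (hφ : IsTest T φ) (w : ℝ × 𝔼) :
    IsTest T fun z => fderiv ℝ φ z w := by
  refine ⟨(hφ.1.fderiv_right (m := ∞) (by simp)).clm_apply contDiff_const,
    hφ.2.1.fderiv_apply ℝ w, ?_⟩
  exact (tsupport_fderiv_apply_subset ℝ w).trans hφ.2.2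

theorem IsTest.mul_left {φ h : ℝ × 𝔼 → ℝ} (hφ : IsTest T φ) (hh : ContDiff ℝ ∞ h) :
    IsTest T fun z => h z * φ z :=
  ⟨hh.mul hφ.1, hφ.2.1.mul_left, (tsupport_mul_subset_right).trans hφ.2.2⟩

theorem isTest_mollifier {k : ℕ} {z : ℝ × 𝔼}
    (h : Metric.closedBall z (bump (ℝ × 𝔼) k).rOut ⊆ slab d T) :
    IsTest T fun y => mollifier volume k (z - y) := by
  have hs : tsupport (fun y => mollifier (volume : Measure (ℝ × 𝔼)) k (z - y)) ⊆
      Metric.closedBall z (bump (ℝ × 𝔼) k).rOut := by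
    refine closure_minimal (fun y hy => ?_) Metric.isClosed_closedBall
    by_contra hy'
    refine hy (mollifier_eq_zero _ ?_)
    rw [Metric.mem_closedBall, dist_comm, dist_eq_norm, not_le] at hy'
    exact hy'.le
  exact ⟨(contDiff_mollifier volume k).comp (by fun_prop),
    (hasCompactSupport_mollifier volume k).comp_homeomorph (Homeomorph.subLeft z), hs.trans h⟩

/-- The mollifier centred at z lives in K, so truncating ψ and G to K is invisible at z although it
destroys the weak derivative across the boundary of K. -/
theorem fderiv_mollify_weakGrad {ψ : ℝ → 𝔼 → ℝ} {G : ℝ → 𝔼 → 𝔼} (hgrad : IsWeakGrad T ψ G)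
    {K : Set (ℝ × 𝔼)} (hK : K ⊆ slab d T)
    (hψ : LocallyIntegrable (K.indicator fun z => ψ z.1 z.2)) {k : ℕ} {z : ℝ × 𝔼}
    (hz : Metric.closedBall z (bump (ℝ × 𝔼) k).rOut ⊆ K) (w : 𝔼) :
    fderiv ℝ (mollify volume k (K.indicator fun z => ψ z.1 z.2)) z (0, w) =
      mollify volume k (K.indicator fun z => inner ℝ (G z.1 z.2) w) z := by
  have htest := isTest_mollifier (hz.trans hK)
  refine fderiv_mollify_eq_of_weak hψ ?_
  have h0 : ∀ y, y ∉ K → mollifier (volume : Measure (ℝ × 𝔼)) k (z - y) = 0 := by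
    intro y hy
    refine mollifier_eq_zero _ ?_
    by_contra h
    refine hy (hz ?_)
    rw [Metric.mem_closedBall, dist_comm, dist_eq_norm]
    exact (not_le.1 h).le
  have h1 : ∀ y, K.indicator (fun z => ψ z.1 z.2) y *
      fderiv ℝ (fun y => mollifier (volume : Measure (ℝ × 𝔼)) k (z - y)) y (0, w) =
      ψ y.1 y.2 * spaceDeriv (fun y => mollifier (volume : Measure (ℝ × 𝔼)) k (z - y)) y w := by
    intro y
    rw [hasFDerivAt_space (htest.1.differentiable (by simp) y)]
    by_cases hy : y ∈ K
    · rw [Set.indicator_of_mem hy]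
    · have : fderiv ℝ (fun y => mollifier (volume : Measure (ℝ × 𝔼)) k (z - y)) y = 0 := by
        -- A nonnegative function vanishing at y has a minimum there; this avoids discussing the
        -- boundary of K.
        refine IsLocalMin.fderiv_eq_zero (Eventually.of_forall fun y' => ?_)
        simp only [h0 y hy]
        exact mollifier_nonneg _ _ _
      simp [this]
  have h2 : ∀ y, K.indicator (fun z => inner ℝ (G z.1 z.2) w) y *
      mollifier (volume : Measure (ℝ × 𝔼)) k (z - y) =
      inner ℝ (G y.1 y.2) w * mollifier (volume : Measure (ℝ × 𝔼)) k (z - y) := by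
    intro y
    by_cases hy : y ∈ K
    · rw [Set.indicator_of_mem hy]
    · simp [h0 y hy]
  simp_rw [h1, h2]
  exact hgrad _ htest w

theorem exists_compact_thickening {K : Set (ℝ × 𝔼)} (hK : IsCompact K) (hKs : K ⊆ slab d T) :
    ∃ δ > 0, IsCompact (Metric.cthickening δ K) ∧ Metric.cthickening δ K ⊆ slab d T ∧
      ∀ᶠ k in atTop, (bump (ℝ × 𝔼) k).rOut < δ := by
  obtain ⟨δ, hδ, h⟩ := hK.exists_cthickening_subset_open isOpen_slab hKs
  exact ⟨δ, hδ, hK.cthickening, h, (tendsto_bump_rOut (V := ℝ × 𝔼)).eventually (gt_mem_nhds hδ)⟩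

theorem deriv_abs_le_one {β : ℝ → ℝ} (hβ : LipschitzWith 1 β) (r : ℝ) : |deriv β r| ≤ 1 := by
  have := norm_deriv_le_of_lipschitz hβ (x₀ := r)
  simpa using this

/-- The chain and product rules for `div (β(ψ) v)`. -/
theorem integral_comp_mul_spaceDeriv {p q : ℝ≥0∞} (hpq : ENNReal.HolderConjugate p q)
    {v : ℝ → 𝔼 → 𝔼} {D : ℝ → 𝔼 → ℝ} (hv : MemLpLoc T q v) (hD : MemLpLoc T q D)
    (hdiv : IsWeakDiv T v D) {ψ : ℝ → 𝔼 → ℝ} {G : ℝ → 𝔼 → 𝔼} (hψ : MemLpLoc T p ψ)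
    (hG : MemLpLoc T p G) (hgrad : IsWeakGrad T ψ G) {β : ℝ → ℝ} (hβ : ContDiff ℝ ∞ β)
    (hβ1 : LipschitzWith 1 β) (hβ0 : β 0 = 0) {φ : ℝ × 𝔼 → ℝ} (hφ : IsTest T φ) :
    ∫ z, β (ψ z.1 z.2) * spaceDeriv φ z (v z.1 z.2) =
      -(∫ z, deriv β (ψ z.1 z.2) * inner ℝ (G z.1 z.2) (v z.1 z.2) * φ z) -
        ∫ z, β (ψ z.1 z.2) * D z.1 z.2 * φ z := by
  obtain ⟨δ, hδ, hK', hK's, hev⟩ := exists_compact_thickening hφ.2.1.isCompact hφ.2.2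
  set K := tsupport φ with hKdef
  set K' := Metric.cthickening δ K with hK'def
  have hKK' : K ⊆ K' := Metric.self_subset_cthickening K
  set μ : Measure (ℝ × 𝔼) := volume
  -- Truncation to a compact neighbourhood of the support of φ makes u and γ globally L^p; once rOut
  -- < δ the mollifiers centred in K do not see it.
  set u := K'.indicator fun z => ψ z.1 z.2 with hu
  set γ : Fin d → ℝ × 𝔼 → ℝ := fun i => K'.indicator fun z => G z.1 z.2 i with hγ
  have hup : MemLp u p μ := memLp_indicator hψ hK' hK's
  have hγp : ∀ i, MemLp (γ i) p μ := fun i => memLp_indicator (hG.apply i) hK' hK's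
  have hul : LocallyIntegrable u μ := hup.locallyIntegrable hpq.one_le
  have hus : ∀ k, ContDiff ℝ ∞ (mollify μ k u) := contDiff_mollify hul
  let e : Fin d → ℝ × 𝔼 := fun i => (0, EuclideanSpace.single i (1 : ℝ))
  have hSi : ∀ i, MemLp (fun z => fderiv ℝ φ z (e i) * v z.1 z.2 i) q μ := fun i =>
    memLp_mul_of_support (hv.apply i) (hφ.fderiv_apply (e i)).1.continuous
      (hφ.fderiv_apply (e i)).2.1 (hφ.fderiv_apply (e i)).2.2
  set S : ℝ × 𝔼 → ℝ := fun z => ∑ i, fderiv ℝ φ z (e i) * v z.1 z.2 i with hS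
  have hSq : MemLp S q μ := memLp_finsetSum _ fun i _ => hSi i
  have hSφ : ∀ z, fderiv ℝ φ z (0, v z.1 z.2) = S z := fun z => by
    rw [fderiv_space_eq_sum, hS]
    exact Finset.sum_congr rfl fun i _ => mul_comm _ _
  have hfq : ∀ i, MemLp (fun z => φ z * v z.1 z.2 i) q μ := fun i =>
    memLp_mul_of_support (hv.apply i) hφ.1.continuous hφ.2.1 hφ.2.2
  have hDq : MemLp (fun z => φ z * D z.1 z.2) q μ :=
    memLp_mul_of_support hD hφ.1.continuous hφ.2.1 hφ.2.2
  have hβ'c : Continuous (deriv β) := hβ.continuous_deriv (by simp)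
  obtain ⟨hSi1, hS2⟩ := tendsto_integral_mul_lipschitz_mollify hpq hSq hup hβ1 hβ0
  obtain ⟨-, hD2⟩ := tendsto_integral_mul_lipschitz_mollify hpq hDq hup hβ1 hβ0
  have hG2 := fun i => tendsto_integral_mul_mul_mollify hpq (hfq i) (hγp i) (C := 1)
    (b := fun k z => deriv β (mollify μ k u z)) (b' := fun z => deriv β (u z))
    (fun k => (hβ'c.comp (hus k).continuous).aestronglyMeasurable)
    (fun k z => deriv_abs_le_one hβ1 _)
    (by filter_upwards [ae_tendsto_mollify hul] with z hz using (hβ'c.tendsto _).comp hz)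
  have hkey : ∀ᶠ k in atTop, (∫ z, S z * β (mollify μ k u z) ∂μ) +
      ∑ i, ∫ z, φ z * v z.1 z.2 i * deriv β (mollify μ k u z) * mollify μ k (γ i) z ∂μ =
      -∫ z, φ z * D z.1 z.2 * β (mollify μ k u z) ∂μ := by
    filter_upwards [hev, hSi1, eventually_all.2 fun i => (hG2 i).1] with k hk h1 h2
    -- The mollified β(u_k) φ is smooth, hence admissible in the definition of the weak divergence;
    -- the classical product and chain rules expand its derivative.
    have htest : IsTest T fun z => β (mollify μ k u z) * φ z := hφ.mul_left (hβ.comp (hus k))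
    have h3 := hdiv _ htest
    rw [← integral_finsetSum _ fun i _ => h2 i,
      ← integral_add h1 (integrable_finsetSum _ fun i _ => h2 i)]
    calc _ = ∫ z, spaceDeriv (fun z => β (mollify μ k u z) * φ z) z (v z.1 z.2) ∂μ := by
          congr 1; ext z
          have hd1 : HasFDerivAt (fun z => β (mollify μ k u z))
              (deriv β (mollify μ k u z) • fderiv ℝ (mollify μ k u) z) z :=
            HasDerivAt.comp_hasFDerivAt (h₂ := β) z
              ((hβ.differentiable (by simp)) _).hasDerivAt
              (((hus k).differentiable (by simp)) z).hasFDerivAt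
          have hd2 := ((hφ.1.differentiable (by simp)) z).hasFDerivAt
          have hd3 : fderiv ℝ (fun z => β (mollify μ k u z) * φ z) z = _ := (hd1.mul hd2).fderiv
          rw [hasFDerivAt_space (htest.1.differentiable (by simp) z), hd3]
          simp only [add_apply, smul_apply, smul_eq_mul]
          rw [hSφ]
          by_cases hz : z ∈ K
          · rw [fderiv_space_eq_sum (mollify μ k u)]
            have hball : Metric.closedBall z (bump (ℝ × 𝔼) k).rOut ⊆ K' :=
              (Metric.closedBall_subset_closedBall hk.le).trans
                (Metric.closedBall_subset_cthickening hz δ)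
            have hw : ∀ i, fderiv ℝ (mollify μ k u) z (0, EuclideanSpace.single i (1 : ℝ)) =
                mollify μ k (γ i) z := fun i => by
              have h := fderiv_mollify_weakGrad hgrad hK's hul hball
                (EuclideanSpace.single i (1 : ℝ))
              simp only [EuclideanSpace.inner_single_right, conj_trivial, one_mul] at h
              exact h
            rw [Finset.sum_congr rfl fun i _ => congrArg (v z.1 z.2 i * ·) (hw i)]
            simp only [Finset.mul_sum]
            rw [mul_comm (S z)]
            congr 1
            refine Finset.sum_congr rfl fun i _ => ?_
            ring
          · rw [image_eq_zero_of_notMem_tsupport hz]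
            simp [mul_comm]
      _ = _ := by
          rw [h3]
          congr 2; ext z; ring
  have hlim1 := hS2.add (tendsto_finsetSum Finset.univ fun i _ => (hG2 i).2)
  have hfin := tendsto_nhds_unique (hlim1.congr' hkey) hD2.neg
  have hGi : ∀ i, Integrable (fun z => φ z * v z.1 z.2 i * deriv β (u z) * γ i z) μ := by
    intro i
    have h1 : Integrable (fun z => φ z * v z.1 z.2 i * γ i z) μ :=
      have := hpq.symm
      (hfq i).integrable_mul (hγp i)
    refine (h1.mul_bdd (c := 1) (hβ'c.comp_aestronglyMeasurable hup.1)
      (ae_of_all _ fun z => deriv_abs_le_one hβ1 (u z))).congr (ae_of_all _ fun z => ?_)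
    simp only; ring
  rw [← integral_finsetSum _ fun i _ => hGi i] at hfin
  have e1 : ∫ z, S z * β (u z) ∂μ = ∫ z, β (ψ z.1 z.2) * spaceDeriv φ z (v z.1 z.2) := by
    congr 1; ext z
    rw [hasFDerivAt_space (hφ.1.differentiable (by simp) z), ← hSφ]
    by_cases hz : z ∈ K
    · rw [hu, Set.indicator_of_mem (hKK' hz), mul_comm]
    · have : fderiv ℝ φ z = 0 := by
        by_contra h
        exact hz (support_fderiv_subset ℝ h)
      simp [this]
  have e2 : ∫ z, ∑ i, φ z * v z.1 z.2 i * deriv β (u z) * γ i z ∂μ =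
      ∫ z, deriv β (ψ z.1 z.2) * inner ℝ (G z.1 z.2) (v z.1 z.2) * φ z := by
    congr 1; ext z
    by_cases hz : z ∈ K
    · simp only [hu, hγ, Set.indicator_of_mem (hKK' hz), PiLp.inner_apply, Finset.mul_sum,
        Finset.sum_mul]
      refine Finset.sum_congr rfl fun i _ => ?_
      simp only [RCLike.inner_apply, conj_trivial]
      ring
    · simp [image_eq_zero_of_notMem_tsupport hz]
  have e3 : ∫ z, φ z * D z.1 z.2 * β (u z) ∂μ = ∫ z, β (ψ z.1 z.2) * D z.1 z.2 * φ z := by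
    congr 1; ext z
    by_cases hz : z ∈ K
    · rw [hu, Set.indicator_of_mem (hKK' hz)]; ring
    · simp [image_eq_zero_of_notMem_tsupport hz]
  rw [e1, e2, e3] at hfin
  linarith

end WeakCalculus

/-! ### Renormalization of the diffusion equation with a source -/

section Renormalization

variable {d : ℕ} {T : ℝ}

local notation "𝔼" => EuclideanSpace ℝ (Fin d)

theorem integral_fderiv_mul_eq_neg {f h : ℝ × 𝔼 → ℝ} (hf : ContDiff ℝ ∞ f) (hh : ContDiff ℝ ∞ h)
    (hc : HasCompactSupport h) (w : ℝ × 𝔼) :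
    ∫ z, f z * fderiv ℝ h z w = -∫ z, fderiv ℝ f z w * h z := by
  have hf' : Continuous fun z => fderiv ℝ f z w :=
    (hf.continuous_fderiv (by simp)).clm_apply continuous_const
  have hh' : Continuous fun z => fderiv ℝ h z w :=
    (hh.continuous_fderiv (by simp)).clm_apply continuous_const
  exact integral_mul_fderiv_eq_neg_fderiv_mul_of_integrable
    ((hf'.mul hh.continuous).integrable_of_hasCompactSupport hc.mul_left)
    ((hf.continuous.mul hh').integrable_of_hasCompactSupport (hc.fderiv_apply ℝ w).mul_left)
    ((hf.continuous.mul hh.continuous).integrable_of_hasCompactSupport hc.mul_left)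
    (fun z _ => hf.differentiable (by simp) z) (fun z _ => hh.differentiable (by simp) z)

theorem integrable_jump_form {u φ : ℝ × 𝔼 → ℝ} (hu : Integrable u) (hφ : Continuous φ)
    (hc : HasCompactSupport φ) (κ : Measure 𝔼) [IsFiniteMeasure κ] :
    Integrable (fun y => ∫ z, u z * (φ z - φ (z + (0, y)))) κ := by
  obtain ⟨D, hD⟩ := hφ.bounded_above_of_compact_support hc
  have hi : Integrable (fun w : 𝔼 × (ℝ × 𝔼) => u w.2 * (φ w.2 - φ (w.2 + (0, w.1))))
      (κ.prod volume) := by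
    refine (hu.comp_snd κ).mul_bdd (c := D + D)
      (Continuous.aestronglyMeasurable (by fun_prop)) (ae_of_all _ fun w => ?_)
    exact (norm_sub_le _ _).trans (add_le_add (hD _) (hD _))
  exact hi.integral_prod_left

/-- A convexity inequality for translations: the nonlocal analogue of `β'' ≥ 0`. -/
theorem integral_comp_mul_sub_translate_le {Ψ φ : ℝ × 𝔼 → ℝ} (hΨ : Integrable Ψ) {β : ℝ → ℝ}
    (hβ : ContDiff ℝ ∞ β) (hβc : ∀ a b, β a - β b ≤ deriv β a * (a - b))
    (hβ1 : LipschitzWith 1 β) (hβ0 : β 0 = 0)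
    (hφ : ContDiff ℝ ∞ φ) (hc : HasCompactSupport φ) (hφ0 : ∀ z, 0 ≤ φ z) (k : ℕ) (w : ℝ × 𝔼) :
    ∫ z, β (mollify volume k Ψ z) * (φ z - φ (z + w)) ≤
      ∫ z, Ψ z * (mollify volume k (fun z => deriv β (mollify volume k Ψ z) * φ z) z -
        mollify volume k (fun z => deriv β (mollify volume k Ψ z) * φ z) (z + w)) := by
  set U := mollify volume k Ψ with hU
  set η := fun z => deriv β (U z) * φ z with hη
  have hUs : ContDiff ℝ ∞ U := contDiff_mollify hΨ.locallyIntegrable k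
  have hUi : Integrable U := integrable_mollify hΨ k
  have hβ'c : Continuous (deriv β) := hβ.continuous_deriv (by simp)
  have hηc : Continuous η := (hβ'c.comp hUs.continuous).mul hφ.continuous
  have hηs : HasCompactSupport η := hc.mul_left
  have hηi : Integrable η := hηc.integrable_of_hasCompactSupport hηs
  obtain ⟨C, hC⟩ := hηc.bounded_above_of_compact_support hηs
  obtain ⟨D, hD⟩ := hφ.continuous.bounded_above_of_compact_support hc
  have hβU : Integrable fun z => β (U z) := by
    refine hUi.mono (hβ.continuous.comp hUs.continuous).aestronglyMeasurable
      (ae_of_all _ fun z => ?_)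
    simpa [hβ0] using hβ1.dist_le_mul (U z) 0
  have hηw : Integrable fun z => η (z + w) := hηi.comp_add_right w
  have hMc : ∀ h : ℝ × 𝔼 → ℝ, Integrable h → AEStronglyMeasurable (mollify volume k h) :=
    fun h hh => (contDiff_mollify hh.locallyIntegrable k).continuous.aestronglyMeasurable
  have hi1 : Integrable fun z => Ψ z * mollify volume k η z :=
    hΨ.mul_bdd (hMc η hηi) (ae_of_all _ fun z => abs_mollify_le hC k z)
  have hi2 : Integrable fun z => Ψ z * mollify volume k (fun y => η (y + w)) z :=
    hΨ.mul_bdd (hMc _ hηw) (ae_of_all _ fun z => abs_mollify_le (fun y => hC (y + w)) k z)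
  have hj1 : Integrable fun z => U z * η z :=
    hUi.mul_bdd hηc.aestronglyMeasurable (ae_of_all _ hC)
  have hj2 : Integrable fun z => U (z - w) * η z :=
    (hUi.comp_sub_right w).mul_bdd hηc.aestronglyMeasurable (ae_of_all _ hC)
  have hl1 : Integrable fun z => β (U z) * φ z :=
    hβU.mul_bdd hφ.continuous.aestronglyMeasurable (ae_of_all _ hD)
  have hl2 : Integrable fun z => β (U (z - w)) * φ z :=
    (hβU.comp_sub_right w).mul_bdd hφ.continuous.aestronglyMeasurable (ae_of_all _ hD)
  have hl3 : Integrable fun z => β (U z) * φ (z + w) :=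
    hβU.mul_bdd (hφ.continuous.comp (by fun_prop)).aestronglyMeasurable
      (ae_of_all _ fun z => hD _)
  -- Moving mollifier and translation onto the other factor turns both sides into integrals against
  -- φ(z), of β(U(z)) - β(U(z-w)) and of β'(U(z)) (U(z) - U(z-w)); convexity then compares them
  -- pointwise.
  have hR : ∫ z, Ψ z * (mollify volume k η z - mollify volume k η (z + w)) =
      ∫ z, (U z * η z - U (z - w) * η z) := by
    simp_rw [mollify_add_right, mul_sub]
    rw [integral_sub hi1 hi2, integral_sub hj1 hj2, integral_mul_mollify hΨ hηi,
      integral_mul_mollify hΨ hηw]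
    congr 1
    rw [← integral_sub_right_eq_self (fun z => U z * η (z + w)) w]
    simp
  have hL : ∫ z, β (U z) * (φ z - φ (z + w)) = ∫ z, (β (U z) * φ z - β (U (z - w)) * φ z) := by
    simp_rw [mul_sub]
    rw [integral_sub hl1 hl3, integral_sub hl1 hl2]
    congr 1
    rw [← integral_sub_right_eq_self (fun z => β (U z) * φ (z + w)) w]
    simp
  rw [hL, hR]
  refine integral_mono (hl1.sub hl2) (hj1.sub hj2) fun z => ?_
  have := mul_le_mul_of_nonneg_right
    (hβc (U z) (U (z - w))) (hφ0 z)
  simp only [hη]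
  linarith

/-- With U the mollification of Ψ, symmetry of mollification and one integration by parts give -∫
β'(U) ∂U φ = -∫ ∂(β(U)) φ; a second integration by parts returns the derivative to φ. -/
theorem integral_mollify_mul_deriv {Ψ φ : ℝ × 𝔼 → ℝ} (hΨ : Integrable Ψ) {β : ℝ → ℝ}
    (hβ : ContDiff ℝ ∞ β) (hφ : ContDiff ℝ ∞ φ) (hc : HasCompactSupport φ) (k : ℕ) (w : ℝ × 𝔼) :
    ∫ z, Ψ z * fderiv ℝ (mollify volume k
      (fun z => deriv β (mollify volume k Ψ z) * φ z)) z w =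
      ∫ z, β (mollify volume k Ψ z) * fderiv ℝ φ z w := by
  set U := mollify volume k Ψ with hU
  set η := fun z => deriv β (U z) * φ z with hη
  have hUs : ContDiff ℝ ∞ U := contDiff_mollify hΨ.locallyIntegrable k
  have hβ' : ContDiff ℝ ∞ (deriv β) := (contDiff_infty_iff_deriv.1 hβ).2
  have hηs : ContDiff ℝ ∞ η := (hβ'.comp hUs).mul hφ
  have hηc : HasCompactSupport η := hc.mul_left
  have hη' : Integrable fun z => fderiv ℝ η z w :=
    ((hηs.continuous_fderiv (by simp)).clm_apply continuous_const).integrable_of_hasCompactSupport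
      (hηc.fderiv_apply ℝ w)
  simp_rw [fderiv_mollify_eq_mollify_fderiv (μ := volume) (hηs.of_le (m := 1) (by simp)) hηc]
  rw [integral_mul_mollify hΨ hη', integral_fderiv_mul_eq_neg hUs hηs hηc,
    integral_fderiv_mul_eq_neg (f := fun z => β (U z)) (hβ.comp hUs) hφ hc]
  congr 2; ext z
  have hd : HasFDerivAt (fun z => β (U z)) (deriv β (U z) • fderiv ℝ U z) z :=
    HasDerivAt.comp_hasFDerivAt (h₂ := β) z ((hβ.differentiable (by simp)) _).hasDerivAt
      ((hUs.differentiable (by simp)) z).hasFDerivAt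
  rw [hd.fderiv, smul_apply, smul_eq_mul, hη]
  ring

/-- Renormalization of the equation `∂ₛ Ψ + (-Δ)^{α/2} Ψ = -g`. -/
theorem integral_renormalized_le {α : ℝ} (hα : 0 < α) (hα' : α ≤ 2) {Ψ : ℝ × 𝔼 → ℝ}
    (hΨ : Integrable Ψ) {g : ℝ → 𝔼 → ℝ} (hg : MemLpLoc T 1 g)
    (heq : ∀ η : ℝ × 𝔼 → ℝ, IsTest T η →
      ∫ z, Ψ z * (timeDeriv η z - fracLaplacian α (fun y => η (z.1, y)) z.2) =
        ∫ z, g z.1 z.2 * η z)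
    {β : ℝ → ℝ} (hβ : ContDiff ℝ ∞ β) (hβc : ∀ a b, β a - β b ≤ deriv β a * (a - b)) (hβ1 : LipschitzWith 1 β)
    (hβ0 : β 0 = 0) {φ : ℝ × 𝔼 → ℝ} (hφ : IsTest T φ) (hφ0 : ∀ z, 0 ≤ φ z) :
    ∫ z, g z.1 z.2 * deriv β (Ψ z) * φ z ≤
      ∫ z, β (Ψ z) * (timeDeriv φ z - fracLaplacian α (fun y => φ (z.1, y)) z.2) := by
  obtain ⟨κ, hκ, hΛ⟩ := exists_jump_form_approx (d := d) hα hα'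
  obtain ⟨δ, hδ, hK', hK's, hev⟩ := exists_compact_thickening hφ.2.1.isCompact hφ.2.2
  set K' := Metric.cthickening δ (tsupport φ) with hK'def
  have hKK' : tsupport φ ⊆ K' := Metric.self_subset_cthickening _
  set μ : Measure (ℝ × 𝔼) := volume
  set γ := K'.indicator fun z => g z.1 z.2 with hγ
  have hγi : MemLp γ 1 μ := memLp_indicator hg hK' hK's
  have hβ'c : Continuous (deriv β) := hβ.continuous_deriv (by simp)
  have hβ' : ContDiff ℝ ∞ (deriv β) := (contDiff_infty_iff_deriv.1 hβ).2
  have hUs : ∀ k, ContDiff ℝ ∞ (mollify μ k Ψ) := contDiff_mollify hΨ.locallyIntegrable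
  have htd : ∀ η : ℝ × 𝔼 → ℝ, IsTest T η → timeDeriv η = fun z => fderiv ℝ η z (1, 0) :=
    fun η hη => funext fun z => hasFDerivAt_time (hη.1.differentiable (by simp) z)
  have hsplit : ∀ η : ℝ × 𝔼 → ℝ, IsTest T η → ∀ u : ℝ × 𝔼 → ℝ, Integrable u →
      ∫ z, u z * (timeDeriv η z - fracLaplacian α (fun y => η (z.1, y)) z.2) =
        (∫ z, u z * fderiv ℝ η z (1, 0)) -
          ∫ z, u z * fracLaplacian α (fun y => η (z.1, y)) z.2 := by
    intro η hη u hu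
    obtain ⟨hm, ⟨C, hC⟩, -⟩ := hΛ η hη.1 hη.2.1
    have h1 := hη.fderiv_apply (1, 0)
    obtain ⟨D, hD⟩ := h1.1.continuous.bounded_above_of_compact_support h1.2.1
    rw [htd η hη]
    simp_rw [mul_sub]
    exact integral_sub (hu.mul_bdd h1.1.continuous.aestronglyMeasurable (ae_of_all _ hD))
      (hu.mul_bdd hm.aestronglyMeasurable (ae_of_all _ hC))
  -- The equation is tested with the mollification of β'(U) φ, which amounts to multiplying the
  -- equation for U by β'(U) φ. Time derivative and source give equalities; only the diffusion loses
  -- something.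
  have hkey : ∀ᶠ k in atTop, ∫ z, φ z * deriv β (mollify μ k Ψ z) * mollify μ k γ z ∂μ ≤
      ∫ z, (timeDeriv φ z - fracLaplacian α (fun y => φ (z.1, y)) z.2) *
        β (mollify μ k Ψ z) ∂μ := by
    filter_upwards [hev] with k hk
    set U := mollify μ k Ψ with hU
    set η := fun z => deriv β (U z) * φ z with hη
    have hηs : ContDiff ℝ ∞ η := (hβ'.comp (hUs k)).mul hφ.1
    have hηc : HasCompactSupport η := hφ.2.1.mul_left
    have hηi : Integrable η μ := hηs.continuous.integrable_of_hasCompactSupport hηc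
    have hφk : tsupport (mollify μ k η) ⊆ K' :=
      (tsupport_mollify_subset k η).trans ((Metric.cthickening_mono hk.le _).trans
        (Metric.cthickening_subset_of_subset δ tsupport_mul_subset_right))
    have htest : IsTest T (mollify μ k η) :=
      ⟨contDiff_mollify hηi.locallyIntegrable k, hasCompactSupport_mollify hηc k, hφk.trans hK's⟩
    have hUi : Integrable U μ := integrable_mollify hΨ k
    have hβU : Integrable (fun z => β (U z)) μ := by
      refine hUi.mono (hβ.continuous.comp (hUs k).continuous).aestronglyMeasurable
        (ae_of_all _ fun z => ?_)
      simpa [hβ0] using hβ1.dist_le_mul (U z) 0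
    have hfrac : ∫ z, β (U z) * fracLaplacian α (fun y => φ (z.1, y)) z.2 ≤
        ∫ z, Ψ z * fracLaplacian α (fun y => mollify μ k η (z.1, y)) z.2 := by
      refine le_of_tendsto_of_tendsto' ((hΛ φ hφ.1 hφ.2.1).2.2 _ hβU)
        ((hΛ _ htest.1 htest.2.1).2.2 Ψ hΨ) fun n => ?_
      have := hκ n
      refine integral_mono (integrable_jump_form hβU hφ.1.continuous hφ.2.1 _)
        (integrable_jump_form hΨ htest.1.continuous htest.2.1 _) fun y => ?_
      exact integral_comp_mul_sub_translate_le hΨ hβ hβc hβ1 hβ0 hφ.1 hφ.2.1 hφ0 k (0, y)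
    have h1 := heq _ htest
    rw [hsplit _ htest Ψ hΨ, integral_mollify_mul_deriv hΨ hβ hφ.1 hφ.2.1 k] at h1
    have h2 : ∫ z, g z.1 z.2 * mollify μ k η z = ∫ z, φ z * deriv β (U z) * mollify μ k γ z ∂μ := by
      calc _ = ∫ z, γ z * mollify μ k η z ∂μ := by
            congr 1; ext z
            by_cases hz : z ∈ K'
            · rw [hγ, Set.indicator_of_mem hz]
            · rw [image_eq_zero_of_notMem_tsupport fun h => hz (hφk h)]; simp
        _ = ∫ z, mollify μ k γ z * η z ∂μ := integral_mul_mollify (memLp_one_iff_integrable.1 hγi) hηi k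
        _ = _ := by congr 1; ext z; rw [hη]; ring
    have h3 := hsplit φ hφ _ hβU
    simp_rw [mul_comm _ (β _)]
    rw [← h2, ← h1, h3]
    linarith
  obtain ⟨hm, ⟨C, hC⟩, -⟩ := hΛ φ hφ.1 hφ.2.1
  have h1 := hφ.fderiv_apply (1, 0)
  obtain ⟨D, hD⟩ := h1.1.continuous.bounded_above_of_compact_support h1.2.1
  obtain ⟨B, hB⟩ := hφ.1.continuous.bounded_above_of_compact_support hφ.2.1
  -- Λφ is bounded but need not have compact support, so the limit k → ∞ pairs L^∞ with the globally
  -- integrable Ψ.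
  have hpq : ENNReal.HolderConjugate 1 ⊤ := inferInstance
  have hφp : MemLp φ ⊤ μ := memLp_top_of_bound hφ.1.continuous.aestronglyMeasurable B
    (ae_of_all _ hB)
  have hsp : MemLp (fun z => timeDeriv φ z - fracLaplacian α (fun y => φ (z.1, y)) z.2) ⊤ μ := by
    refine memLp_top_of_bound (C := D + C) ?_ (ae_of_all _ fun z => ?_)
    · rw [htd φ hφ]
      exact h1.1.continuous.aestronglyMeasurable.sub hm.aestronglyMeasurable
    · rw [htd φ hφ]
      exact (norm_sub_le _ _).trans (add_le_add (hD _) (hC _))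
  have hl := (tendsto_integral_mul_mul_mollify hpq hφp hγi (C := 1)
    (b := fun k z => deriv β (mollify μ k Ψ z)) (b' := fun z => deriv β (Ψ z))
    (fun k => (hβ'c.comp (hUs k).continuous).aestronglyMeasurable)
    (fun k z => deriv_abs_le_one hβ1 _)
    (by filter_upwards [ae_tendsto_mollify hΨ.locallyIntegrable] with z hz
          using (hβ'c.tendsto _).comp hz)).2
  have hr := (tendsto_integral_mul_lipschitz_mollify hpq hsp (memLp_one_iff_integrable.2 hΨ)
    hβ1 hβ0).2
  have := le_of_tendsto_of_tendsto hl hr hkey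
  calc _ = ∫ z, φ z * deriv β (Ψ z) * γ z ∂μ := by
        congr 1; ext z
        by_cases hz : z ∈ tsupport φ
        · rw [hγ, Set.indicator_of_mem (hKK' hz)]; ring
        · rw [image_eq_zero_of_notMem_tsupport hz]; simp
    _ ≤ _ := this
    _ = _ := by congr 1; ext z; ring

end Renormalization

/-! ### A smooth convex approximation of the absolute value -/

section SmoothAbs

/-- A smooth convex approximation of the absolute value. -/
noncomputable def smoothAbs (δ r : ℝ) : ℝ := Real.sqrt (r ^ 2 + δ ^ 2) - δ

variable {δ : ℝ}

theorem hasDerivAt_smoothAbs (hδ : 0 < δ) (r : ℝ) :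
    HasDerivAt (smoothAbs δ) (r / Real.sqrt (r ^ 2 + δ ^ 2)) r := by
  have h1 : HasDerivAt (fun r : ℝ => r ^ 2 + δ ^ 2) (2 * r) r := by
    simpa using (hasDerivAt_pow 2 r).add_const (δ ^ 2)
  have h2 := (h1.sqrt (by positivity)).sub_const δ
  rw [mul_div_mul_left _ _ two_ne_zero] at h2
  exact h2

theorem contDiff_smoothAbs (hδ : 0 < δ) : ContDiff ℝ ∞ (smoothAbs δ) := by
  refine (ContDiff.sqrt (by fun_prop) fun r => ?_).sub contDiff_const
  positivity

theorem smoothAbs_zero (hδ : 0 < δ) : smoothAbs δ 0 = 0 := by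
  simp [smoothAbs, Real.sqrt_sq hδ.le]

theorem smoothAbs_sub_le (hδ : 0 < δ) (a b : ℝ) :
    smoothAbs δ a - smoothAbs δ b ≤ deriv (smoothAbs δ) a * (a - b) := by
  rw [(hasDerivAt_smoothAbs hδ a).deriv]
  have hA : 0 < Real.sqrt (a ^ 2 + δ ^ 2) := Real.sqrt_pos.2 (by positivity)
  have hA2 : Real.sqrt (a ^ 2 + δ ^ 2) * Real.sqrt (a ^ 2 + δ ^ 2) = a ^ 2 + δ ^ 2 :=
    Real.mul_self_sqrt (by positivity)
  -- Cauchy–Schwarz for (a, δ) and (b, δ), which is the convexity of r ↦ √(r²+δ²).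
  have hAB : a * b + δ ^ 2 ≤ Real.sqrt (a ^ 2 + δ ^ 2) * Real.sqrt (b ^ 2 + δ ^ 2) := by
    rw [← Real.sqrt_mul (by positivity)]
    refine Real.le_sqrt_of_sq_le ?_
    nlinarith [mul_nonneg (sq_nonneg δ) (sq_nonneg (a - b))]
  rw [smoothAbs, smoothAbs, div_mul_eq_mul_div, le_div_iff₀ hA]
  nlinarith

theorem lipschitzWith_smoothAbs (hδ : 0 < δ) : LipschitzWith 1 (smoothAbs δ) := by
  refine lipschitzWith_of_nnnorm_deriv_le
    (fun r => (hasDerivAt_smoothAbs hδ r).differentiableAt) fun r => ?_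
  rw [← NNReal.coe_le_coe, coe_nnnorm, (hasDerivAt_smoothAbs hδ r).deriv, Real.norm_eq_abs,
    abs_div, abs_of_nonneg (Real.sqrt_nonneg _), NNReal.coe_one]
  refine div_le_one_of_le₀ (Real.abs_le_sqrt ?_) (Real.sqrt_nonneg _)
  have := sq_nonneg δ
  linarith

theorem abs_smoothAbs_le (hδ : 0 < δ) (r : ℝ) : |smoothAbs δ r| ≤ |r| := by
  have := (lipschitzWith_smoothAbs hδ).dist_le_mul r 0
  simpa [smoothAbs_zero hδ] using this

/-- With A = √(r²+δ²) the quantity is δ - δ²/A, and A ≥ δ. It is the coefficient of div v left over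
by renormalization; a bound uniform in r makes this error vanish with δ. -/
theorem mul_deriv_smoothAbs_sub_mem (hδ : 0 < δ) (r : ℝ) :
    |r * deriv (smoothAbs δ) r - smoothAbs δ r| ≤ δ := by
  rw [(hasDerivAt_smoothAbs hδ r).deriv, smoothAbs]
  set A := Real.sqrt (r ^ 2 + δ ^ 2) with hAdef
  have hA : 0 < A := Real.sqrt_pos.2 (by positivity)
  have hA2 : A * A = r ^ 2 + δ ^ 2 := Real.mul_self_sqrt (by positivity)
  have hδA : δ ≤ A := Real.le_sqrt_of_sq_le (by nlinarith [sq_nonneg r])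
  have h1 : r * (r / A) - (A - δ) = δ - δ ^ 2 / A := by
    field_simp
    nlinarith
  have h2 : δ ^ 2 / A ≤ δ := by
    rw [div_le_iff₀ hA]; nlinarith
  rw [h1, abs_of_nonneg (by linarith)]
  have : 0 ≤ δ ^ 2 / A := by positivity
  linarith

theorem tendsto_smoothAbs (r : ℝ) : Tendsto (fun δ => smoothAbs δ r) (𝓝 0) (𝓝 |r|) := by
  have : Continuous fun δ : ℝ => smoothAbs δ r := by unfold smoothAbs; fun_prop
  have h := this.tendsto 0
  simpa [smoothAbs, Real.sqrt_sq_eq_abs] using h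

end SmoothAbs

/-! ### Integrability of solutions and Kato's inequality -/

section Solution

variable {d : ℕ} {T : ℝ}

local notation "𝔼" => EuclideanSpace ℝ (Fin d)

theorem MemLpLoc.mul {p q : ℝ≥0∞} (hpq : ENNReal.HolderConjugate p q)
    {f g : ℝ → 𝔼 → ℝ} (hf : MemLpLoc T p f) (hg : MemLpLoc T q g) :
    MemLpLoc T 1 (fun s x => f s x * g s x) := fun K hK hKs =>
  memLp_one_iff_integrable.2 (MemLp.integrable_mul (hf K hK hKs) (hg K hK hKs))

theorem MemLpLoc.real_inner {p q : ℝ≥0∞} (hpq : ENNReal.HolderConjugate p q)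
    {f g : ℝ → 𝔼 → 𝔼} (hf : MemLpLoc T p f) (hg : MemLpLoc T q g) :
    MemLpLoc T 1 (fun s x => inner ℝ (f s x) (g s x)) := by
  intro K hK hKs
  have h : (fun z : ℝ × 𝔼 => inner ℝ (f z.1 z.2) (g z.1 z.2)) =
      fun z => ∑ i, f z.1 z.2 i * g z.1 z.2 i := by
    ext z
    rw [PiLp.inner_apply]
    exact Finset.sum_congr rfl fun i _ => by simp [mul_comm]
  rw [h]
  exact memLp_finsetSum _ fun i _ => MemLpLoc.mul hpq (hf.apply i) (hg.apply i) K hK hKs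

theorem MemLpLoc.integrable_mul_test {g : ℝ → 𝔼 → ℝ} (hg : MemLpLoc T 1 g) {φ : ℝ × 𝔼 → ℝ}
    (hφ : IsTest T φ) : Integrable fun z => g z.1 z.2 * φ z := by
  have := memLp_one_iff_integrable.1
    (memLp_mul_of_support hg hφ.1.continuous hφ.2.1 hφ.2.2)
  exact this.congr (ae_of_all _ fun z => mul_comm _ _)

theorem integrable_mul_spaceDeriv {p q : ℝ≥0∞} (hpq : ENNReal.HolderConjugate p q)
    {f : ℝ → 𝔼 → ℝ} {v : ℝ → 𝔼 → 𝔼} (hf : MemLpLoc T p f) (hv : MemLpLoc T q v)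
    {φ : ℝ × 𝔼 → ℝ} (hφ : IsTest T φ) :
    Integrable fun z => f z.1 z.2 * spaceDeriv φ z (v z.1 z.2) := by
  have h : ∀ z : ℝ × 𝔼, f z.1 z.2 * spaceDeriv φ z (v z.1 z.2) =
      ∑ i, f z.1 z.2 * v z.1 z.2 i * fderiv ℝ φ z (0, EuclideanSpace.single i (1 : ℝ)) := by
    intro z
    rw [hasFDerivAt_space (hφ.1.differentiable (by simp) z), fderiv_space_eq_sum, Finset.mul_sum]
    exact Finset.sum_congr rfl fun i _ => by ring
  simp_rw [h]
  exact integrable_finsetSum _ fun i _ =>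
    (MemLpLoc.mul hpq hf (hv.apply i)).integrable_mul_test (hφ.fderiv_apply _)

/-- The slab is covered by countably many compact boxes. Joint measurability has to come from here,
since continuity in time with values in L¹ is formulated slice by slice. -/
theorem aestronglyMeasurable_slab {p : ℝ≥0∞} {f : ℝ → 𝔼 → ℝ} (hf : MemLpLoc T p f) :
    AEStronglyMeasurable (fun z : ℝ × 𝔼 => f z.1 z.2) (volume.restrict (slab d T)) := by
  let K : ℕ → Set (ℝ × 𝔼) := fun n =>
    Set.Icc (1 / ((n : ℝ) + 1)) (T - 1 / ((n : ℝ) + 1)) ×ˢ Metric.closedBall 0 n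
  have hKs : ∀ n, K n ⊆ slab d T := by
    intro n z hz
    have hn : (0 : ℝ) < 1 / ((n : ℝ) + 1) := by positivity
    exact ⟨⟨hn.trans_le hz.1.1, hz.1.2.trans_lt (by linarith)⟩, trivial⟩
  have hU : slab d T ⊆ ⋃ n, K n := by
    intro z hz
    obtain ⟨n1, h1⟩ := exists_nat_one_div_lt hz.1.1
    obtain ⟨n2, h2⟩ := exists_nat_one_div_lt (sub_pos.2 hz.1.2)
    obtain ⟨n3, h3⟩ := exists_nat_ge ‖z.2‖
    refine Set.mem_iUnion.2 ⟨max n1 (max n2 n3), ⟨?_, ?_⟩, ?_⟩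
    · exact (Nat.one_div_le_one_div (le_max_left _ _)).trans h1.le
    · have := Nat.one_div_le_one_div (α := ℝ)
        ((le_max_left n2 n3).trans (le_max_right n1 (max n2 n3)))
      linarith
    · rw [mem_closedBall_zero_iff]
      refine h3.trans ?_
      exact_mod_cast (le_max_right n2 n3).trans (le_max_right n1 (max n2 n3))
  have := (aestronglyMeasurable_iUnion_iff (s := K) (f := fun z : ℝ × 𝔼 => f z.1 z.2)
    (μ := volume)).2 fun n =>
      (hf (K n) (isCompact_Icc.prod (isCompact_closedBall 0 _)) (hKs n)).1
  exact this.mono_measure (Measure.restrict_mono hU le_rfl)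

theorem continuousOn_integral_slice {u : ℝ → 𝔼 → ℝ} (hi : ∀ s ∈ Set.Icc 0 T, Integrable (u s))
    (hc : ∀ s ∈ Set.Icc 0 T,
      Tendsto (fun τ => eLpNorm (u τ - u s) 1 volume) (𝓝[Set.Icc 0 T] s) (𝓝 0)) :
    ContinuousOn (fun s => ∫ x, u s x) (Set.Icc 0 T) := fun s hs =>
  tendsto_integral_of_L1' (u s) (hi s hs).1
    (eventually_nhdsWithin_of_forall fun τ hτ => hi τ hτ) (hc s hs)

theorem tendsto_eLpNorm_abs_sub {u : ℝ → 𝔼 → ℝ} {s : ℝ}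
    (hc : Tendsto (fun τ => eLpNorm (u τ - u s) 1 volume) (𝓝[Set.Icc 0 T] s) (𝓝 0)) :
    Tendsto (fun τ => eLpNorm ((fun x => |u τ x|) - fun x => |u s x|) 1 volume)
      (𝓝[Set.Icc 0 T] s) (𝓝 0) := by
  refine tendsto_of_tendsto_of_tendsto_of_le_of_le tendsto_const_nhds hc (fun _ => zero_le)
    fun τ => eLpNorm_mono fun x => ?_
  exact abs_abs_sub_abs_le_abs_sub _ _

variable {α : ℝ} {p q : ℝ≥0∞}
  {v : ℝ → EuclideanSpace ℝ (Fin d) → EuclideanSpace ℝ (Fin d)}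
  {ψ₀ : EuclideanSpace ℝ (Fin d) → ℝ} {ψ : ℝ → EuclideanSpace ℝ (Fin d) → ℝ}

/-- By Tonelli, since s ↦ ∫ |ψ(s)| is continuous on the compact [0, T]. The extension by zero is
what gets mollified in space-time. -/
theorem IsSolution.integrable_slab (hψ : IsSolution α p T v ψ₀ ψ) :
    Integrable ((slab d T).indicator fun z => ψ z.1 z.2) := by
  rw [integrable_indicator_iff isOpen_slab.measurableSet]
  have hr : (volume : Measure (ℝ × 𝔼)).restrict (slab d T) =
      ((volume : Measure ℝ).restrict (Set.Ioo 0 T)).prod (volume : Measure 𝔼) := by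
    rw [slab, Measure.volume_eq_prod, ← Measure.prod_restrict, Measure.restrict_univ]
  have hm := aestronglyMeasurable_slab hψ.memLpLoc
  rw [hr] at hm
  rw [IntegrableOn, hr, integrable_prod_iff hm]
  constructor
  · filter_upwards [ae_restrict_mem measurableSet_Ioo] with s hs
    exact hψ.integrable s (Set.Ioo_subset_Icc_self hs)
  · have := continuousOn_integral_slice (u := fun s x => |ψ s x|)
      (fun s hs => (hψ.integrable s hs).abs)
      (fun s hs => tendsto_eLpNorm_abs_sub (hψ.continuous s hs))
    exact (this.integrableOn_Icc).mono_set Set.Ioo_subset_Icc_self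

/-- The two integrals in the weak formulation of the equation, separated. -/
theorem IsSolution.equation_split (hα : 0 < α) (hα' : α ≤ 2)
    (hpq : ENNReal.HolderConjugate p q) (hv : MemLpLoc T q v)
    (hψ : IsSolution α p T v ψ₀ ψ) {φ : ℝ × 𝔼 → ℝ} (hφ : IsTest T φ) :
    (∫ z, (slab d T).indicator (fun z => ψ z.1 z.2) z *
      (timeDeriv φ z - fracLaplacian α (fun y => φ (z.1, y)) z.2)) +
      ∫ z, ψ z.1 z.2 * spaceDeriv φ z (v z.1 z.2) = 0 := by
  obtain ⟨κ, hκ, hΛ⟩ := exists_jump_form_approx (d := d) hα hα'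
  obtain ⟨hm, ⟨C, hC⟩, -⟩ := hΛ φ hφ.1 hφ.2.1
  have h1 := hφ.fderiv_apply (1, 0)
  obtain ⟨D, hD⟩ := h1.1.continuous.bounded_above_of_compact_support h1.2.1
  have htd : timeDeriv φ = fun z => fderiv ℝ φ z (1, 0) :=
    funext fun z => hasFDerivAt_time (hφ.1.differentiable (by simp) z)
  have hi : Integrable fun z => (slab d T).indicator (fun z => ψ z.1 z.2) z *
      (timeDeriv φ z - fracLaplacian α (fun y => φ (z.1, y)) z.2) := by
    refine hψ.integrable_slab.mul_bdd (c := D + C) ?_ (ae_of_all _ fun z => ?_)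
    · rw [htd]
      exact h1.1.continuous.aestronglyMeasurable.sub hm.aestronglyMeasurable
    · rw [htd]
      exact (norm_sub_le _ _).trans (add_le_add (hD _) (hC _))
  rw [← integral_add hi (integrable_mul_spaceDeriv hpq hψ.memLpLoc hv hφ), ← hψ.equation φ hφ]
  congr 1; ext z
  by_cases hz : z ∈ slab d T
  · rw [Set.indicator_of_mem hz]; ring
  -- Off the slab the time lies outside (0, T), so the entire slice of φ vanishes; this kills the
  -- nonlocal term too, and no boundary term arises from the extension by zero.
  · have hz1 : ∀ y, φ (z.1, y) = 0 := fun y => by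
      refine image_eq_zero_of_notMem_tsupport fun h => hz ?_
      exact ⟨(hφ.2.2 h).1, trivial⟩
    have h2 : timeDeriv φ z = 0 := by
      rw [htd]
      have : fderiv ℝ φ z = 0 := by
        by_contra h
        exact hz (hφ.2.2 (support_fderiv_subset ℝ h))
      simp [this]
    have h3 : fracLaplacian α (fun y => φ (z.1, y)) z.2 = 0 := by
      simp [fracLaplacian, hz1, Real.fourier_eq', Real.fourierInv_eq']
    rw [Set.indicator_of_notMem hz, h2, h3]
    ring

/-- Kato's inequality for the transport-diffusion equation. -/
theorem IsSolution.kato (hα : 0 < α) (hα' : α ≤ 2)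
    (hpq : ENNReal.HolderConjugate p q) (hv : IsAdmissibleField q T v)
    (hψ : IsSolution α p T v ψ₀ ψ) {φ : ℝ × 𝔼 → ℝ} (hφ : IsTest T φ) (hφ0 : ∀ z, 0 ≤ φ z) :
    0 ≤ (∫ z, (slab d T).indicator (fun z => |ψ z.1 z.2|) z *
      (timeDeriv φ z - fracLaplacian α (fun y => φ (z.1, y)) z.2)) +
      ∫ z, |ψ z.1 z.2| * spaceDeriv φ z (v z.1 z.2) := by
  obtain ⟨D, hD, hdiv⟩ := hv.div
  obtain ⟨G, hG, hgrad⟩ := hψ.grad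
  have hvq := hv.memLpLoc
  set Ψ := (slab d T).indicator fun z : ℝ × 𝔼 => ψ z.1 z.2 with hΨdef
  have hΨ : Integrable Ψ := hψ.integrable_slab
  have hin : MemLpLoc T 1 fun s x => inner ℝ (G s x) (v s x) := MemLpLoc.real_inner hpq hG hvq
  have hψD : MemLpLoc T 1 fun s x => ψ s x * D s x := MemLpLoc.mul hpq hψ.memLpLoc hD
  have hg : MemLpLoc T 1 fun s x => inner ℝ (G s x) (v s x) + ψ s x * D s x :=
    fun K hK hKs => (hin K hK hKs).add (hψD K hK hKs)
  have hΨeq : ∀ z ∈ slab d T, Ψ z = ψ z.1 z.2 := fun z hz => Set.indicator_of_mem hz _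
  have htest0 : ∀ η : ℝ × 𝔼 → ℝ, IsTest T η → ∀ z, z ∉ slab d T → η z = 0 := fun η hη z hz =>
    image_eq_zero_of_notMem_tsupport fun h => hz (hη.2.2 h)
  have heq : ∀ η : ℝ × 𝔼 → ℝ, IsTest T η →
      ∫ z, Ψ z * (timeDeriv η z - fracLaplacian α (fun y => η (z.1, y)) z.2) =
        ∫ z, (inner ℝ (G z.1 z.2) (v z.1 z.2) + ψ z.1 z.2 * D z.1 z.2) * η z := by
    intro η hη
    have h1 := hψ.equation_split hα hα' hpq hvq hη
    -- For β = id the chain rule reads div(v ψ) = G·v + ψD, so the transport term becomes a source.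
    have h2 := integral_comp_mul_spaceDeriv hpq hvq hD hdiv hψ.memLpLoc hG hgrad (β := id)
      contDiff_id LipschitzWith.id rfl hη
    simp only [id, deriv_id', one_mul] at h2
    simp_rw [add_mul]
    rw [integral_add (hin.integrable_mul_test hη) (hψD.integrable_mul_test hη)]
    linarith
  obtain ⟨κ, hκ, hΛ⟩ := exists_jump_form_approx (d := d) hα hα'
  obtain ⟨hm, ⟨C, hC⟩, -⟩ := hΛ φ hφ.1 hφ.2.1
  have h1 := hφ.fderiv_apply (1, 0)
  obtain ⟨B, hB⟩ := h1.1.continuous.bounded_above_of_compact_support h1.2.1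
  have htd : timeDeriv φ = fun z => fderiv ℝ φ z (1, 0) :=
    funext fun z => hasFDerivAt_time (hφ.1.differentiable (by simp) z)
  have hop : AEStronglyMeasurable
      (fun z => timeDeriv φ z - fracLaplacian α (fun y => φ (z.1, y)) z.2) volume := by
    rw [htd]
    exact h1.1.continuous.aestronglyMeasurable.sub hm.aestronglyMeasurable
  have hopb : ∀ z, |timeDeriv φ z - fracLaplacian α (fun y => φ (z.1, y)) z.2| ≤ B + C := by
    intro z
    rw [htd]
    exact (norm_sub_le _ _).trans (add_le_add (hB _) (hC _))
  have hDφ : Integrable fun z => D z.1 z.2 * φ z := by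
    have hD1 : MemLpLoc T 1 D := by
      intro K hK hKs
      have : IsFiniteMeasure ((volume : Measure (ℝ × 𝔼)).restrict K) :=
        ⟨by simpa using hK.measure_lt_top⟩
      exact (hD K hK hKs).mono_exponent hpq.symm.one_le
    exact hD1.integrable_mul_test hφ
  have hS : Integrable fun z => ψ z.1 z.2 * spaceDeriv φ z (v z.1 z.2) :=
    integrable_mul_spaceDeriv hpq hψ.memLpLoc hvq hφ
  -- Kato's inequality for the smoothed absolute value, with an error of order δ.
  have hlower : ∀ δ : ℝ, 0 < δ → -(δ * ∫ z, |D z.1 z.2 * φ z|) ≤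
      (∫ z, smoothAbs δ (Ψ z) *
        (timeDeriv φ z - fracLaplacian α (fun y => φ (z.1, y)) z.2)) +
      ∫ z, smoothAbs δ (ψ z.1 z.2) * spaceDeriv φ z (v z.1 z.2) := by
    intro δ hδ
    have hβ := contDiff_smoothAbs hδ
    have hβL := lipschitzWith_smoothAbs hδ
    have hβ'c : Continuous (deriv (smoothAbs δ)) := hβ.continuous_deriv (by simp)
    have e1 := integral_renormalized_le hα hα' hΨ hg heq hβ (smoothAbs_sub_le hδ) hβL
      (smoothAbs_zero hδ) hφ hφ0
    have e2 := integral_comp_mul_spaceDeriv hpq hvq hD hdiv hψ.memLpLoc hG hgrad hβ hβL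
      (smoothAbs_zero hδ) hφ
    have hΨm := hΨ.1
    have i1 : Integrable fun z =>
        deriv (smoothAbs δ) (ψ z.1 z.2) * inner ℝ (G z.1 z.2) (v z.1 z.2) * φ z := by
      have := (hin.integrable_mul_test hφ).mul_bdd (c := 1)
        (hβ'c.comp_aestronglyMeasurable hΨm) (ae_of_all _ fun z => deriv_abs_le_one hβL (Ψ z))
      refine this.congr (ae_of_all _ fun z => ?_)
      by_cases hz : z ∈ slab d T
      · simp only [hΨeq z hz]; ring
      · simp [htest0 φ hφ z hz]
    have i2 : Integrable fun z =>
        (ψ z.1 z.2 * deriv (smoothAbs δ) (ψ z.1 z.2) - smoothAbs δ (ψ z.1 z.2)) *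
          D z.1 z.2 * φ z := by
      have := hDφ.mul_bdd (c := δ) (g := fun z =>
          Ψ z * deriv (smoothAbs δ) (Ψ z) - smoothAbs δ (Ψ z))
        ((hΨm.mul (hβ'c.comp_aestronglyMeasurable hΨm)).sub
          (hβ.continuous.comp_aestronglyMeasurable hΨm))
        (ae_of_all _ fun z => mul_deriv_smoothAbs_sub_mem hδ (Ψ z))
      refine this.congr (ae_of_all _ fun z => ?_)
      by_cases hz : z ∈ slab d T
      · simp only [hΨeq z hz]; ring
      · simp [htest0 φ hφ z hz]
    have i3 : Integrable fun z => smoothAbs δ (ψ z.1 z.2) * D z.1 z.2 * φ z := by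
      have hβψ : MemLpLoc T p fun s x => smoothAbs δ (ψ s x) := fun K hK hKs =>
        (hψ.memLpLoc K hK hKs).of_le
          (hβ.continuous.comp_aestronglyMeasurable (hψ.memLpLoc K hK hKs).1)
          (ae_of_all _ fun z => abs_smoothAbs_le hδ _)
      exact (MemLpLoc.mul hpq hβψ hD).integrable_mul_test hφ
    -- Here ψD β'(ψ) is split as (ψβ'(ψ) - β(ψ))D + β(ψ)D, so that with β'(ψ) G·v the last piece
    -- forms div(β(ψ)v), which `e2` converts back to a flux term.
    have e3 : ∫ z, (inner ℝ (G z.1 z.2) (v z.1 z.2) + ψ z.1 z.2 * D z.1 z.2) *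
        deriv (smoothAbs δ) (Ψ z) * φ z =
        (∫ z, deriv (smoothAbs δ) (ψ z.1 z.2) * inner ℝ (G z.1 z.2) (v z.1 z.2) * φ z) +
        ((∫ z, (ψ z.1 z.2 * deriv (smoothAbs δ) (ψ z.1 z.2) - smoothAbs δ (ψ z.1 z.2)) *
          D z.1 z.2 * φ z) + ∫ z, smoothAbs δ (ψ z.1 z.2) * D z.1 z.2 * φ z) := by
      have h23 := integral_add i2 i3
      have h123 := integral_add i1 (i2.add i3)
      simp only [Pi.add_apply] at h123
      rw [← h23, ← h123]
      congr 1; ext z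
      by_cases hz : z ∈ slab d T
      · simp only [hΨeq z hz]; ring
      · simp [htest0 φ hφ z hz]
    have e4 : -(δ * ∫ z, |D z.1 z.2 * φ z|) ≤ ∫ z, (ψ z.1 z.2 * deriv (smoothAbs δ) (ψ z.1 z.2) -
        smoothAbs δ (ψ z.1 z.2)) * D z.1 z.2 * φ z := by
      rw [← integral_const_mul, ← integral_neg]
      refine integral_mono (hDφ.abs.const_mul δ).neg i2 fun z => ?_
      have h5 := mul_le_mul_of_nonneg_right (mul_deriv_smoothAbs_sub_mem hδ (ψ z.1 z.2))
        (abs_nonneg (D z.1 z.2 * φ z))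
      rw [← abs_mul] at h5
      have := (abs_le.1 h5).1
      simp only
      linarith
    linarith
  have hlim1 : Tendsto (fun n : ℕ => ∫ z, smoothAbs (1 / ((n : ℝ) + 1)) (Ψ z) *
      (timeDeriv φ z - fracLaplacian α (fun y => φ (z.1, y)) z.2)) atTop
      (𝓝 (∫ z, |Ψ z| * (timeDeriv φ z - fracLaplacian α (fun y => φ (z.1, y)) z.2))) := by
    refine tendsto_integral_of_dominated_convergence (fun z => |Ψ z| * (B + C)) (fun n => ?_)
      (hΨ.abs.mul_const _) (fun n => ae_of_all _ fun z => ?_) (ae_of_all _ fun z => ?_)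
    · exact ((contDiff_smoothAbs (by positivity)).continuous.comp_aestronglyMeasurable
        hΨ.1).mul hop
    · rw [Real.norm_eq_abs, abs_mul]
      exact mul_le_mul (abs_smoothAbs_le (by positivity) _) (hopb z) (abs_nonneg _)
        (abs_nonneg _)
    · exact ((tendsto_smoothAbs (Ψ z)).comp tendsto_one_div_add_atTop_nhds_zero_nat).mul_const _
  have hlim2 : Tendsto (fun n : ℕ => ∫ z, smoothAbs (1 / ((n : ℝ) + 1)) (ψ z.1 z.2) *
      spaceDeriv φ z (v z.1 z.2)) atTop
      (𝓝 (∫ z, |ψ z.1 z.2| * spaceDeriv φ z (v z.1 z.2))) := by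
    refine tendsto_integral_of_dominated_convergence
      (fun z => |ψ z.1 z.2 * spaceDeriv φ z (v z.1 z.2)|) (fun n => ?_)
      hS.abs (fun n => ae_of_all _ fun z => ?_) (ae_of_all _ fun z => ?_)
    · refine (integrable_mul_spaceDeriv hpq (f := fun s x => smoothAbs (1 / ((n : ℝ) + 1)) (ψ s x))
        (fun K hK hKs => ?_) hvq hφ).1
      exact (hψ.memLpLoc K hK hKs).of_le
        ((contDiff_smoothAbs (by positivity)).continuous.comp_aestronglyMeasurable
          (hψ.memLpLoc K hK hKs).1)
        (ae_of_all _ fun z => abs_smoothAbs_le (by positivity) _)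
    · rw [Real.norm_eq_abs, abs_mul, abs_mul]
      exact mul_le_mul_of_nonneg_right (abs_smoothAbs_le (by positivity) _) (abs_nonneg _)
    · exact ((tendsto_smoothAbs (ψ z.1 z.2)).comp
        tendsto_one_div_add_atTop_nhds_zero_nat).mul_const _
  have hlim0 : Tendsto (fun n : ℕ => -(1 / ((n : ℝ) + 1) * ∫ z, |D z.1 z.2 * φ z|)) atTop
      (𝓝 0) := by
    have := ((tendsto_one_div_add_atTop_nhds_zero_nat (𝕜 := ℝ)).mul_const
      (∫ z, |D z.1 z.2 * φ z|)).neg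
    simpa using this
  have hfin := le_of_tendsto_of_tendsto' hlim0 (hlim1.add hlim2)
    fun n => hlower _ (by positivity)
  have habs : (slab d T).indicator (fun z : ℝ × 𝔼 => |ψ z.1 z.2|) = fun z => |Ψ z| := by
    ext z
    by_cases hz : z ∈ slab d T
    · simp [hΨdef, hz]
    · simp [hΨdef, hz]
  rw [habs]
  exact hfin

end Solution

/-! ### Monotonicity from the sign of the distributional derivative -/

section Monotone

/-- θ(s) = ∫ ρ_k over [s-b, s-a] is a smoothed indicator of [a, b]. Pairing its derivative with a
function compares the mollified values at a and b. -/
theorem exists_primitive_mollifier_sub (k : ℕ) {a b : ℝ} (hab : a ≤ b) :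
    ∃ θ : ℝ → ℝ, ContDiff ℝ ∞ θ ∧ (∀ s, 0 ≤ θ s) ∧
      (∀ s, HasDerivAt θ (mollifier volume k (s - a) - mollifier volume k (s - b)) s) ∧
      tsupport θ ⊆ Set.Icc (a - (bump ℝ k).rOut) (b + (bump ℝ k).rOut) := by
  set ρ : ℝ → ℝ := mollifier volume k with hρ
  have hρc : Continuous ρ := (contDiff_mollifier volume k).continuous
  have hi : ∀ x y, IntervalIntegrable ρ volume x y := fun x y => hρc.intervalIntegrable x y
  have hP : ∀ s, HasDerivAt (fun x => ∫ t in (0 : ℝ)..x, ρ t) (ρ s) s := fun s =>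
    intervalIntegral.integral_hasDerivAt_right (hi 0 s)
      (hρc.stronglyMeasurableAtFilter _ _) hρc.continuousAt
  have heq : ∀ s, ∫ t in (s - b)..(s - a), ρ t =
      (∫ t in (0 : ℝ)..(s - a), ρ t) - ∫ t in (0 : ℝ)..(s - b), ρ t := fun s =>
    (intervalIntegral.integral_interval_sub_left (hi _ _) (hi _ _)).symm
  have hd : ∀ s, HasDerivAt (fun s => ∫ t in (s - b)..(s - a), ρ t) (ρ (s - a) - ρ (s - b)) s := by
    intro s
    simp_rw [heq]
    exact ((hP (s - a)).comp_sub_const s a).sub ((hP (s - b)).comp_sub_const s b)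
  refine ⟨fun s => ∫ t in (s - b)..(s - a), ρ t, ?_, fun s => ?_, hd, ?_⟩
  · rw [contDiff_infty_iff_deriv]
    refine ⟨fun s => (hd s).differentiableAt, ?_⟩
    have : deriv (fun s => ∫ t in (s - b)..(s - a), ρ t) = fun s => ρ (s - a) - ρ (s - b) :=
      funext fun s => (hd s).deriv
    rw [this]
    have hs : ContDiff ℝ ∞ ρ := contDiff_mollifier volume k
    exact (hs.comp (by fun_prop)).sub (hs.comp (by fun_prop))
  · exact intervalIntegral.integral_nonneg (by linarith) fun t _ => mollifier_nonneg volume k t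
  · refine closure_minimal (fun s hs => ?_) isClosed_Icc
    by_contra hs'
    refine hs ?_
    change ∫ t in (s - b)..(s - a), ρ t = 0
    rw [intervalIntegral.integral_congr (g := fun _ => (0 : ℝ)), intervalIntegral.integral_zero]
    intro t ht
    rw [Set.uIcc_of_le (by linarith)] at ht
    refine mollifier_eq_zero volume ?_
    rw [Set.mem_Icc, not_and_or, not_le, not_le] at hs'
    rw [Real.norm_eq_abs]
    rcases hs' with h | h
    · exact le_trans (by linarith [ht.2]) (neg_le_abs t)
    · exact le_trans (by linarith [ht.1]) (le_abs_self t)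

/-- A continuous function on `[0, T]` with nonpositive distributional derivative on `(0, T)` stays
below its initial value. -/
theorem le_of_forall_integral_deriv_mul_nonneg {T : ℝ} (hT : 0 < T) {M : ℝ → ℝ}
    (hM : ContinuousOn M (Set.Icc 0 T))
    (h : ∀ θ : ℝ → ℝ, ContDiff ℝ ∞ θ → HasCompactSupport θ → tsupport θ ⊆ Set.Ioo 0 T →
      (∀ s, 0 ≤ θ s) → 0 ≤ ∫ s in Set.Ioo 0 T, deriv θ s * M s) :
    ∀ s ∈ Set.Icc 0 T, M s ≤ M 0 := by
  -- The constant extension is continuous on ℝ, so its mollifications converge at every point, not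
  -- just almost everywhere.
  set N : ℝ → ℝ := Set.IccExtend hT.le ((Set.Icc 0 T).domRestrict M) with hN
  have hNc : Continuous N := (continuousOn_iff_continuous_domRestrict.1 hM).Icc_extend'
  have hNM : ∀ s ∈ Set.Icc 0 T, N s = M s := fun s hs => by
    rw [hN, Set.IccExtend_of_mem hT.le _ hs]; rfl
  have hlim : ∀ a, Tendsto (fun k => mollify volume k N a) atTop (𝓝 (N a)) := fun a =>
    ContDiffBump.convolution_tendsto_right_of_continuous tendsto_bump_rOut hNc a
  have hanti : ∀ a b, 0 < a → a ≤ b → b < T → N b ≤ N a := by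
    intro a b ha hab hb
    refine le_of_tendsto_of_tendsto (hlim b) (hlim a) ?_
    filter_upwards [(tendsto_bump_rOut (V := ℝ)).eventually (gt_mem_nhds ha),
      (tendsto_bump_rOut (V := ℝ)).eventually (gt_mem_nhds (sub_pos.2 hb))] with k hka hkb
    obtain ⟨θ, hθ, hθ0, hθd, hθs⟩ := exists_primitive_mollifier_sub k hab
    have hsub : Set.Icc (a - (bump ℝ k).rOut) (b + (bump ℝ k).rOut) ⊆ Set.Ioo 0 T :=
      fun s hs => ⟨by linarith [hs.1], by linarith [hs.2]⟩
    have hc : HasCompactSupport θ :=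
      (isCompact_Icc (a := a - (bump ℝ k).rOut)).of_isClosed_subset (isClosed_tsupport θ) hθs
    have h1 := h θ hθ hc (hθs.trans hsub) hθ0
    have h2 : ∫ s in Set.Ioo 0 T, deriv θ s * M s = ∫ s, deriv θ s * N s := by
      refine Eq.trans ?_ (setIntegral_eq_integral_of_forall_compl_eq_zero (s := Set.Ioo 0 T) ?_)
      · refine setIntegral_congr_fun measurableSet_Ioo fun s hs => ?_
        simp only [hNM s (Set.Ioo_subset_Icc_self hs)]
      · intro s hs
        have : deriv θ s = 0 := by
          by_contra h
          exact hs (hsub (hθs (support_deriv_subset h)))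
        rw [this, zero_mul]
    have h3 : ∀ c s, mollifier (volume : Measure ℝ) k (s - c) = mollifier volume k (c - s) :=
      fun c s => by rw [← mollifier_neg, neg_sub]
    have h4 : ∫ s, deriv θ s * N s = mollify volume k N a - mollify volume k N b := by
      rw [mollify_apply', mollify_apply', ← integral_sub
        (integrable_mollifier_mul hNc.locallyIntegrable k a)
        (integrable_mollifier_mul hNc.locallyIntegrable k b)]
      congr 1; ext s
      rw [(hθd s).deriv, h3 a, h3 b]; ring
    linarith
  have h0 : ∀ b, 0 < b → b < T → N b ≤ N 0 := by
    intro b hb hbT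
    refine ge_of_tendsto (f := N) (x := 𝓝[>] 0) (hNc.continuousWithinAt.tendsto) ?_
    filter_upwards [Ioc_mem_nhdsGT hb] with a ha using hanti a b ha.1 ha.2 hbT
  intro s hs
  rw [← hNM s hs, ← hNM 0 (Set.left_mem_Icc.2 hT.le)]
  rcases hs.1.eq_or_lt with rfl | hs0
  · exact le_rfl
  refine le_of_tendsto (f := N) (x := 𝓝[<] s) (hNc.continuousWithinAt.tendsto) ?_
  filter_upwards [Ioo_mem_nhdsLT hs0] with b hb using h0 b hb.1 (hb.2.trans_le hs.2)

end Monotone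

/-! ### Cut-off argument: the mass of a subsolution -/

section Mass

variable {d : ℕ} {T : ℝ}

local notation "𝔼" => EuclideanSpace ℝ (Fin d)

theorem fracLaplacian_const_mul (α c : ℝ) (f : 𝔼 → ℝ) (x : 𝔼) :
    fracLaplacian α (fun y => c * f y) x = c * fracLaplacian α f x := by
  have h1 : ∀ ξ : 𝔼, 𝓕 (fun y : 𝔼 => ((c * f y : ℝ) : ℂ)) ξ = c * 𝓕 (fun y : 𝔼 => (f y : ℂ)) ξ := by
    intro ξ
    rw [Real.fourier_eq', Real.fourier_eq', ← integral_const_mul]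
    congr 1; ext y
    simp only [smul_eq_mul, Complex.ofReal_mul]; ring
  rw [fracLaplacian, fracLaplacian, ← Complex.re_ofReal_mul, Real.fourierInv_eq',
    Real.fourierInv_eq', ← integral_const_mul]
  congr 2; ext ξ
  rw [h1]
  simp only [smul_eq_mul]; ring

theorem isTest_mul {θ : ℝ → ℝ} (hθ : ContDiff ℝ ∞ θ) (hθc : HasCompactSupport θ)
    (hθs : tsupport θ ⊆ Set.Ioo 0 T) {χ : 𝔼 → ℝ} (hχ : ContDiff ℝ ∞ χ)
    (hχc : HasCompactSupport χ) : IsTest T fun z : ℝ × 𝔼 => θ z.1 * χ z.2 := by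
  have hs : tsupport (fun z : ℝ × 𝔼 => θ z.1 * χ z.2) ⊆ tsupport θ ×ˢ tsupport χ := by
    refine closure_minimal (fun z hz => ?_) ((isClosed_tsupport θ).prod (isClosed_tsupport χ))
    exact ⟨subset_tsupport _ (left_ne_zero_of_mul hz), subset_tsupport _ (right_ne_zero_of_mul hz)⟩
  refine ⟨(hθ.comp contDiff_fst).mul (hχ.comp contDiff_snd), ?_, fun z hz => ?_⟩
  · exact (hθc.isCompact.prod hχc.isCompact).of_isClosed_subset (isClosed_tsupport _) hs
  · exact ⟨hθs (hs hz).1, trivial⟩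

theorem setIntegral_slab_time_mul {u : ℝ → 𝔼 → ℝ}
    (hui : Integrable ((slab d T).indicator fun z : ℝ × 𝔼 => u z.1 z.2)) {f : ℝ → ℝ}
    (hf : Continuous f) {C : ℝ} (hC : ∀ s, |f s| ≤ C) :
    ∫ z, (slab d T).indicator (fun z : ℝ × 𝔼 => u z.1 z.2) z * f z.1 =
      ∫ s in Set.Ioo 0 T, f s * ∫ x, u s x := by
  have hi : Integrable fun z : ℝ × 𝔼 => (slab d T).indicator (fun z => u z.1 z.2) z * f z.1 :=
    hui.mul_bdd (hf.comp continuous_fst).aestronglyMeasurable (ae_of_all _ fun z => hC z.1)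
  have he : (fun z : ℝ × 𝔼 => (slab d T).indicator (fun z => u z.1 z.2) z * f z.1) =
      (slab d T).indicator fun z => u z.1 z.2 * f z.1 := by
    ext z
    by_cases hz : z ∈ slab d T <;> simp [hz]
  rw [he] at hi ⊢
  rw [integral_indicator isOpen_slab.measurableSet]
  rw [integrable_indicator_iff isOpen_slab.measurableSet] at hi
  have := setIntegral_prod (fun z : ℝ × 𝔼 => u z.1 z.2 * f z.1) hi
  rw [← Measure.volume_eq_prod] at this
  rw [slab, this]
  refine setIntegral_congr_fun measurableSet_Ioo fun s _ => ?_
  simp only [Measure.restrict_univ]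
  rw [integral_mul_const, mul_comm]

/-- A spatial cut-off function. -/
noncomputable def cutoff (d : ℕ) : ContDiffBump (0 : EuclideanSpace ℝ (Fin d)) :=
  ⟨1, 2, one_pos, one_lt_two⟩

/-- The total mass of a subsolution does not exceed its initial value. -/
theorem integral_le_of_subsolution (hT : 0 < T) (α : ℝ) (hα : 0 < α)
    (hα' : α ≤ 2) {p q : ℝ≥0∞} (hpq : ENNReal.HolderConjugate p q)
    {v : ℝ → EuclideanSpace ℝ (Fin d) → EuclideanSpace ℝ (Fin d)} (hv : MemLpLoc T q v)
    {u : ℝ → EuclideanSpace ℝ (Fin d) → ℝ} (hu : MemLpLoc T p u)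
    (hi : ∀ s ∈ Set.Icc 0 T, Integrable (u s))
    (hc : ∀ s ∈ Set.Icc 0 T,
      Tendsto (fun τ => eLpNorm (u τ - u s) 1 volume) (𝓝[Set.Icc 0 T] s) (𝓝 0))
    (hui : Integrable ((slab d T).indicator fun z => u z.1 z.2))
    (hgrowth : ∀ a b : ℝ, 0 < a → b < T → IntegrableOn
      (fun z : ℝ × 𝔼 => ‖v z.1 z.2‖ * |u z.1 z.2| / (1 + ‖z.2‖)) (Set.Icc a b ×ˢ Set.univ))
    (hsub : ∀ φ : ℝ × 𝔼 → ℝ, IsTest T φ → (∀ z, 0 ≤ φ z) →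
      0 ≤ (∫ z, (slab d T).indicator (fun z => u z.1 z.2) z *
        (timeDeriv φ z - fracLaplacian α (fun y => φ (z.1, y)) z.2)) +
        ∫ z, u z.1 z.2 * spaceDeriv φ z (v z.1 z.2)) :
    ∀ s ∈ Set.Icc 0 T, ∫ x, u s x ≤ ∫ x, u 0 x := by
  refine le_of_forall_integral_deriv_mul_nonneg hT (continuousOn_integral_slice hi hc)
    fun θ hθ hθc hθs hθ0 => ?_
  set U := (slab d T).indicator fun z : ℝ × 𝔼 => u z.1 z.2 with hU
  let χ : 𝔼 → ℝ := cutoff d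
  have hχdef : χ = cutoff d := rfl
  have hχ : ContDiff ℝ ∞ χ := (cutoff d).contDiff
  have hχc : HasCompactSupport χ := (cutoff d).hasCompactSupport
  have hχ1 : ∀ x, |χ x| ≤ 1 := fun x => by
    rw [abs_of_nonneg (cutoff d).nonneg]; exact (cutoff d).le_one
  obtain ⟨A, hA⟩ := hθ.continuous.bounded_above_of_compact_support hθc
  have hθ'c : Continuous (deriv θ) := hθ.continuous_deriv (by simp)
  obtain ⟨A', hA'⟩ := hθ'c.bounded_above_of_compact_support hθc.deriv
  obtain ⟨B, hB⟩ := (hχ.continuous_fderiv (by simp)).bounded_above_of_compact_support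
    (hχc.fderiv ℝ)
  have hB0 : 0 ≤ B := (norm_nonneg _).trans (hB 0)
  have hA0 : 0 ≤ A := (norm_nonneg _).trans (hA 0)
  obtain ⟨C, hC⟩ := abs_fracLaplacian_comp_smul_le α χ
  let R : ℕ → ℝ := fun n => (n : ℝ) + 1
  have hR : ∀ n, 1 ≤ R n := fun n => by simp [R]
  have hR0 : ∀ n, 0 < R n := fun n => zero_lt_one.trans_le (hR n)
  have hRlim : Tendsto R atTop atTop := tendsto_natCast_atTop_atTop.atTop_add tendsto_const_nhds
  have hRinv : Tendsto (fun n => (R n)⁻¹) atTop (𝓝 0) := tendsto_inv_atTop_zero.comp hRlim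
  let χR : ℕ → 𝔼 → ℝ := fun n x => χ ((R n)⁻¹ • x)
  have hχR : ∀ n, ContDiff ℝ ∞ (χR n) := fun n => hχ.comp (by fun_prop)
  have hχRc : ∀ n, HasCompactSupport (χR n) := fun n =>
    hχc.comp_homeomorph (Homeomorph.smulOfNeZero (R n)⁻¹ (inv_ne_zero (hR0 n).ne'))
  have htest : ∀ n, IsTest T fun z : ℝ × 𝔼 => θ z.1 * χR n z.2 := fun n =>
    isTest_mul hθ hθc hθs (hχR n) (hχRc n)
  have hpt : ∀ n (z : ℝ × 𝔼), timeDeriv (fun z : ℝ × 𝔼 => θ z.1 * χR n z.2) z -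
      fracLaplacian α (fun y => θ z.1 * χR n y) z.2 =
      deriv θ z.1 * χR n z.2 - θ z.1 * fracLaplacian α (χR n) z.2 := by
    intro n z
    rw [fracLaplacian_const_mul, timeDeriv]
    refine congrArg (· - _) ?_
    exact (((hθ.differentiable (by simp) z.1).hasDerivAt).mul_const (χR n z.2)).deriv
  have hsp : ∀ n (z : ℝ × 𝔼) w, spaceDeriv (fun z : ℝ × 𝔼 => θ z.1 * χR n z.2) z w =
      θ z.1 * ((R n)⁻¹ * fderiv ℝ χ ((R n)⁻¹ • z.2) w) := by
    intro n z w
    have h1 : HasFDerivAt (χR n) ((R n)⁻¹ • fderiv ℝ χ ((R n)⁻¹ • z.2)) z.2 := by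
      have h2 := (hχ.differentiable (by simp) ((R n)⁻¹ • z.2)).hasFDerivAt
      have h3 : HasFDerivAt (fun x : 𝔼 => (R n)⁻¹ • x)
          ((R n)⁻¹ • ContinuousLinearMap.id ℝ 𝔼) z.2 :=
          ((R n)⁻¹ • ContinuousLinearMap.id ℝ 𝔼).hasFDerivAt
      have h4 : HasFDerivAt (χR n) _ z.2 := h2.comp z.2 h3
      refine h4.congr_fderiv ?_
      ext w; simp
    rw [spaceDeriv, (h1.const_mul (θ z.1)).fderiv]
    simp
  have hlim1 : Tendsto (fun n => ∫ z, U z * (deriv θ z.1 * χR n z.2)) atTop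
      (𝓝 (∫ z, U z * deriv θ z.1)) := by
    refine tendsto_integral_of_dominated_convergence (fun z => |U z| * A') (fun n => ?_)
      (hui.abs.mul_const _) (fun n => ae_of_all _ fun z => ?_) (ae_of_all _ fun z => ?_)
    · exact hui.1.mul ((hθ'c.comp continuous_fst).mul
        ((hχR n).continuous.comp continuous_snd)).aestronglyMeasurable
    · rw [Real.norm_eq_abs, abs_mul, abs_mul]
      gcongr
      exact (mul_le_of_le_one_right (abs_nonneg _) (hχ1 _)).trans (hA' z.1)
    · refine Tendsto.const_mul _ ?_
      have h1 : Tendsto (fun n => χR n z.2) atTop (𝓝 (χ ((0 : ℝ) • z.2))) :=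
        (hχ.continuous.tendsto _).comp (hRinv.smul_const z.2)
      have h2 : χ ((0 : ℝ) • z.2) = 1 := by
        rw [zero_smul]
        exact (cutoff d).one_of_mem_closedBall (by simp [(cutoff d).rIn_pos.le])
      rw [h2] at h1
      simpa using h1.const_mul (deriv θ z.1)
  have hi1 : ∀ n, Integrable fun z => U z * (deriv θ z.1 * χR n z.2) := fun n =>
    hui.mul_bdd (c := A') ((hθ'c.comp continuous_fst).mul
        ((hχR n).continuous.comp continuous_snd)).aestronglyMeasurable (ae_of_all _ fun z => by
      rw [Real.norm_eq_abs, abs_mul]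
      exact (mul_le_of_le_one_right (abs_nonneg _) (hχ1 _)).trans (hA' z.1))
  have hfb : ∀ n (z : ℝ × 𝔼), |θ z.1 * fracLaplacian α (χR n) z.2| ≤ A * (C * R n ^ (-α)) := by
    intro n z
    rw [abs_mul]
    exact mul_le_mul (hA z.1) (hC (R n) (hR0 n) z.2) (abs_nonneg _) hA0
  have hfm : ∀ n, AEStronglyMeasurable
      (fun z : ℝ × 𝔼 => θ z.1 * fracLaplacian α (χR n) z.2) volume := by
    intro n
    -- Measurability is read off from the space-time test function θ χ_R, since Λ acts in x only and
    -- θ factors out.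
    obtain ⟨κ, -, hΛ⟩ := exists_jump_form_approx (d := d) hα hα'
    have := (hΛ _ (htest n).1 (htest n).2.1).1
    simp_rw [fracLaplacian_const_mul] at this
    exact this.aestronglyMeasurable
  have hi2 : ∀ n, Integrable fun z => U z * (θ z.1 * fracLaplacian α (χR n) z.2) := fun n =>
    hui.mul_bdd (hfm n) (ae_of_all _ (hfb n))
  have hlim2 : Tendsto (fun n => ∫ z, U z * (θ z.1 * fracLaplacian α (χR n) z.2)) atTop
      (𝓝 0) := by
    have h1 : Tendsto (fun n => (∫ z, |U z|) * (A * (C * R n ^ (-α)))) atTop (𝓝 0) := by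
      have := (((tendsto_rpow_neg_atTop hα).comp hRlim).const_mul C).const_mul A
      simpa using this.const_mul (∫ z, |U z|)
    refine squeeze_zero_norm (fun n => ?_) h1
    rw [← integral_mul_const]
    refine norm_integral_le_of_norm_le (hui.abs.mul_const _) (ae_of_all _ fun z => ?_)
    rw [Real.norm_eq_abs, abs_mul]
    gcongr
    exact hfb n z
  have hlim3 : Tendsto (fun n => ∫ z, u z.1 z.2 *
      spaceDeriv (fun z : ℝ × 𝔼 => θ z.1 * χR n z.2) z (v z.1 z.2)) atTop (𝓝 0) := by
    obtain ⟨a, b, ha, hb, hab⟩ : ∃ a b : ℝ, 0 < a ∧ b < T ∧ tsupport θ ⊆ Set.Icc a b := by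
      rcases (tsupport θ).eq_empty_or_nonempty with h | h
      -- The support is empty, so any a > 0 and b < T will do.
      · exact ⟨T, 0, hT, hT, by simp [h]⟩
      · obtain ⟨a, ha, ha'⟩ := hθc.isCompact.exists_isLeast h
        obtain ⟨b, hb, hb'⟩ := hθc.isCompact.exists_isGreatest h
        exact ⟨a, b, (hθs ha).1, (hθs hb).2, fun s hs => ⟨ha' hs, hb' hs⟩⟩
    have hgr := (hgrowth a b ha hb).integrable_indicator
      (measurableSet_Icc.prod MeasurableSet.univ)
    have h0 : (𝓝 (0 : ℝ)) = 𝓝 (∫ _ : ℝ × 𝔼, (0 : ℝ)) := by simp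
    rw [h0]
    refine tendsto_integral_of_dominated_convergence _ (fun n => ?_)
      (hgr.const_mul (A * (3 * B))) (fun n => ae_of_all _ fun z => ?_) (ae_of_all _ fun z => ?_)
    · exact (integrable_mul_spaceDeriv hpq hu hv (htest n)).1
    · rw [hsp]
      by_cases hz : z.1 ∈ tsupport θ
      · rw [Set.indicator_of_mem (show z ∈ Set.Icc a b ×ˢ Set.univ from ⟨hab hz, trivial⟩)]
        -- The gradient of the cut-off lives in ‖x‖ ≤ 2R, where 1 + ‖x‖ ≤ 3R because R ≥ 1. This
        -- bound, uniform in R, is why the growth condition carries the weight 1/(1+‖x‖).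
        have h2 : (R n)⁻¹ * ‖fderiv ℝ χ ((R n)⁻¹ • z.2)‖ ≤ 3 * B / (1 + ‖z.2‖) := by
          rw [le_div_iff₀ (by positivity)]
          by_cases hx : ‖(R n)⁻¹ • z.2‖ ≤ 2
          · rw [norm_smul, norm_inv, Real.norm_of_nonneg (hR0 n).le, inv_mul_le_iff₀ (hR0 n)] at hx
            have h3 : 1 + ‖z.2‖ ≤ 3 * R n := by linarith [hR n]
            calc (R n)⁻¹ * ‖fderiv ℝ χ ((R n)⁻¹ • z.2)‖ * (1 + ‖z.2‖)
                ≤ (R n)⁻¹ * B * (3 * R n) := by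
                  have := (hR0 n).le
                  gcongr
                  exact hB _
              _ = 3 * B := by
                  have := (hR0 n).ne'
                  field_simp
          · have : fderiv ℝ χ ((R n)⁻¹ • z.2) = 0 := by
              by_contra h
              have := support_fderiv_subset ℝ h
              rw [hχdef, (cutoff d).tsupport_eq, mem_closedBall_zero_iff] at this
              exact hx this
            rw [this]; simp; positivity
        have h4 := (fderiv ℝ χ ((R n)⁻¹ • z.2)).le_opNorm (v z.1 z.2)
        calc ‖u z.1 z.2 * (θ z.1 * ((R n)⁻¹ * fderiv ℝ χ ((R n)⁻¹ • z.2) (v z.1 z.2)))‖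
            = |u z.1 z.2| * (‖θ z.1‖ * ((R n)⁻¹ * ‖fderiv ℝ χ ((R n)⁻¹ • z.2) (v z.1 z.2)‖)) := by
              rw [norm_mul, norm_mul, norm_mul, norm_inv, Real.norm_of_nonneg (hR0 n).le,
                Real.norm_eq_abs (u z.1 z.2)]
          _ ≤ |u z.1 z.2| * (A * (3 * B / (1 + ‖z.2‖) * ‖v z.1 z.2‖)) := by
              have h5 : (R n)⁻¹ * ‖fderiv ℝ χ ((R n)⁻¹ • z.2) (v z.1 z.2)‖ ≤
                  3 * B / (1 + ‖z.2‖) * ‖v z.1 z.2‖ :=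
                calc _ ≤ (R n)⁻¹ * (‖fderiv ℝ χ ((R n)⁻¹ • z.2)‖ * ‖v z.1 z.2‖) := by
                      have := (inv_pos.2 (hR0 n)).le
                      gcongr
                  _ = (R n)⁻¹ * ‖fderiv ℝ χ ((R n)⁻¹ • z.2)‖ * ‖v z.1 z.2‖ := by ring
                  _ ≤ _ := by gcongr
              have h6 : 0 ≤ (R n)⁻¹ * ‖fderiv ℝ χ ((R n)⁻¹ • z.2) (v z.1 z.2)‖ := by
                have := (inv_pos.2 (hR0 n)).le
                positivity
              exact mul_le_mul_of_nonneg_left (mul_le_mul (hA z.1) h5 h6 hA0) (abs_nonneg _)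
          _ = A * (3 * B) * (‖v z.1 z.2‖ * |u z.1 z.2| / (1 + ‖z.2‖)) := by ring
      · rw [image_eq_zero_of_notMem_tsupport hz]
        simp only [zero_mul, mul_zero, norm_zero]
        refine mul_nonneg (by positivity) (Set.indicator_nonneg (fun z _ => by positivity) z)
    · simp_rw [hsp]
      have h1 : Tendsto (fun n => (R n)⁻¹ * fderiv ℝ χ ((R n)⁻¹ • z.2) (v z.1 z.2)) atTop
          (𝓝 0) := by
        refine squeeze_zero_norm (a := fun n => (R n)⁻¹ * (B * ‖v z.1 z.2‖)) (fun n => ?_) ?_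
        · rw [norm_mul, norm_inv, Real.norm_of_nonneg (hR0 n).le]
          have := (inv_pos.2 (hR0 n)).le
          gcongr
          exact (ContinuousLinearMap.le_opNorm _ _).trans (by gcongr; exact hB _)
        · simpa using hRinv.mul_const (B * ‖v z.1 z.2‖)
      simpa using (h1.const_mul (θ z.1)).const_mul (u z.1 z.2)
  have hnonneg : ∀ n, 0 ≤ (∫ z, U z * (deriv θ z.1 * χR n z.2)) -
      (∫ z, U z * (θ z.1 * fracLaplacian α (χR n) z.2)) +
      ∫ z, u z.1 z.2 * spaceDeriv (fun z : ℝ × 𝔼 => θ z.1 * χR n z.2) z (v z.1 z.2) := by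
    intro n
    have h1 := hsub _ (htest n) fun z => mul_nonneg (hθ0 _) (cutoff d).nonneg
    simp_rw [hpt] at h1
    rw [← integral_sub (hi1 n) (hi2 n)]
    simp_rw [← mul_sub]
    exact h1
  have hfin := ge_of_tendsto' ((hlim1.sub hlim2).add hlim3) hnonneg
  rw [sub_zero, add_zero, setIntegral_slab_time_mul hui hθ'c hA'] at hfin
  exact hfin

end Mass

/-! ### The L¹ bound and conservation of mass -/

section Solution

variable {d : ℕ} {T α : ℝ} {p q : ℝ≥0∞} {v : ℝ → EuclideanSpace ℝ (Fin d) → EuclideanSpace ℝ (Fin d)}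
  {ψ₀ : EuclideanSpace ℝ (Fin d) → ℝ} {ψ : ℝ → EuclideanSpace ℝ (Fin d) → ℝ}

/-- The `L¹` norm of a solution does not exceed its initial value. -/
theorem IsSolution.integral_abs_le (hα : 0 < α) (hα' : α ≤ 2)
    (hpq : ENNReal.HolderConjugate p q) (hT : 0 < T) (hv : IsAdmissibleField q T v)
    (hψ : IsSolution α p T v ψ₀ ψ) : ∀ s ∈ Set.Icc 0 T, ∫ x, |ψ s x| ≤ ∫ x, |ψ 0 x| := by
  refine integral_le_of_subsolution (u := fun s x => |ψ s x|) hT α hα hα' hpq hv.memLpLoc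
    (fun K hK hKs => (hψ.memLpLoc K hK hKs).abs) (fun s hs => (hψ.integrable s hs).abs)
    (fun s hs => tendsto_eLpNorm_abs_sub (hψ.continuous s hs)) ?_ ?_
    fun φ hφ hφ0 => hψ.kato hα hα' hpq hv hφ hφ0
  · have h := hψ.integrable_slab.abs
    have he : (fun z => |(slab d T).indicator (fun z => ψ z.1 z.2) z|) =
        (slab d T).indicator fun z => |ψ z.1 z.2| :=
      (Set.indicator_comp_of_zero (g := fun r : ℝ => |r|) abs_zero).symm
    rwa [he] at h
  · simpa only [abs_abs] using hψ.growth

/-- The equation itself supplies the subsolution inequality, as an equality, so Kato's inequality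
and the divergence of v play no role in mass conservation. -/
theorem IsSolution.integral_le (hα : 0 < α) (hα' : α ≤ 2)
    (hpq : ENNReal.HolderConjugate p q) (hT : 0 < T) (hv : MemLpLoc T q v)
    (hψ : IsSolution α p T v ψ₀ ψ) : ∀ s ∈ Set.Icc 0 T, ∫ x, ψ s x ≤ ∫ x, ψ 0 x :=
  integral_le_of_subsolution hT α hα hα' hpq hv hψ.memLpLoc hψ.integrable hψ.continuous
    hψ.integrable_slab hψ.growth fun _ hφ _ => (hψ.equation_split hα hα' hpq hv hφ).ge

/-- The equation is linear: `-ψ` solves it with initial datum `-ψ₀`. -/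
theorem IsSolution.neg (hψ : IsSolution α p T v ψ₀ ψ) :
    IsSolution α p T v (-ψ₀) (fun s => -ψ s) where
  integrable s hs := (hψ.integrable s hs).neg
  continuous s hs := by
    refine (hψ.continuous s hs).congr fun τ => ?_
    rw [← eLpNorm_neg]
    congr 1
    abel
  initial := hψ.initial.neg
  memLpLoc K hK hKs := (hψ.memLpLoc K hK hKs).neg
  grad := by
    obtain ⟨G, hG, hgrad⟩ := hψ.grad
    refine ⟨fun s => -G s, fun K hK hKs => (hG K hK hKs).neg, fun φ hφ w => ?_⟩
    simp only [Pi.neg_apply, neg_mul, inner_neg_left, integral_neg, hgrad φ hφ w]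
  growth a b ha hb := by
    simpa only [Pi.neg_apply, abs_neg] using hψ.growth a b ha hb
  equation φ hφ := by
    simp only [Pi.neg_apply, neg_mul, integral_neg, hψ.equation φ hφ, neg_zero]

/-- The mass of a solution is conserved. -/
theorem IsSolution.integral_eq (hα : 0 < α) (hα' : α ≤ 2)
    (hpq : ENNReal.HolderConjugate p q) (hT : 0 < T) (hv : MemLpLoc T q v)
    (hψ : IsSolution α p T v ψ₀ ψ) {s : ℝ} (hs : s ∈ Set.Icc 0 T) :
    ∫ x, ψ s x = ∫ x, ψ 0 x := by
  refine le_antisymm (hψ.integral_le hα hα' hpq hT hv s hs) ?_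
  have h := hψ.neg.integral_le hα hα' hpq hT hv s hs
  simpa only [Pi.neg_apply, integral_neg, neg_le_neg_iff] using h

end Solution

end TransportDiffusion

theorem proposition3p2 {d : ℕ} (hd : 1 ≤ d) {α : ℝ} (hα : 0 < α) (hα' : α ≤ 2)
    {p q : ℝ≥0∞} (hpq : ENNReal.HolderConjugate p q) {T : ℝ} (hT : 0 < T)
    (v : ℝ → EuclideanSpace ℝ (Fin d) → EuclideanSpace ℝ (Fin d))
    (hv : TransportDiffusion.IsAdmissibleField q T v)
    (ψ₀ : EuclideanSpace ℝ (Fin d) → ℝ) (ψ : ℝ → EuclideanSpace ℝ (Fin d) → ℝ)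
    (hψ : TransportDiffusion.IsSolution α p T v ψ₀ ψ) :
    ∀ s ∈ Set.Icc 0 T,
      eLpNorm (ψ s) 1 volume ≤ eLpNorm ψ₀ 1 volume ∧ ∫ x, ψ s x = ∫ x, ψ₀ x := by
  intro s hs
  have h0 := Set.left_mem_Icc.2 hT.le
  constructor
  · rw [← eLpNorm_congr_ae hψ.initial, eLpNorm_one_eq_lintegral_enorm,
      eLpNorm_one_eq_lintegral_enorm, ← ofReal_integral_norm_eq_lintegral_enorm (hψ.integrable s hs),
      ← ofReal_integral_norm_eq_lintegral_enorm (hψ.integrable 0 h0)]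
    exact ENNReal.ofReal_le_ofReal (hψ.integral_abs_le hα hα' hpq hT hv s hs)
  · rw [hψ.integral_eq hα hα' hpq hT hv.memLpLoc hs, integral_congr_ae hψ.initial]
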